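/- **Setting.** Let $\beta>0$ and $q=\lfloor 2/\beta\rfloor$. For every sample size $n$ let $\Sigma_n\in\mathbb R^{d_n\times d_n}$ be positive semi-definite with $\|\Sigma_n\|_{op}=1$ and effective dimension $d_{\mathrm{eff}}=\mathrm{tr}(\Sigma_n)/\|\Sigma_n\|_{op}$, and assume $d_{\mathrm{eff}}/n^{\beta}\to c_0$ for some $c_0>0$. Let $W$ be a random vector with i.i.d. entries that are either standard normal, or of mean zero, unit variance and bounded by $R$, where $R$ does not depend on $n$. The input law $P_X$ (depending on $n$) is, for all $n$, the law of $\Sigma_n^{1/2}W$ (*covariance model*), or, for all $n$, the law of $\sqrt{d_{\mathrm{eff}}}\,Z/\|Z\|$ with $Z=\Sigma_n^{1/2}W$ (*spherical model*). Let $(x,y)$ have a joint law with input marginal $P_X$ and $\mathbb E|y|<\infty$; the ground truth $f^\star(x)=\mathbb E[y\mid X=x]$ (which may depend on $n$) is bounded, uniformly in $n$. For each $n$ the inputs $\mathbf X=(x_1,\dots,x_n)$ are i.i.d. with law $P_X$, all on one probability space, with arbitrary dependence between different $n$. Let $g$ be a function of three real variables that does not depend on $n$, and let $k_\tau(x,x')=g\big(\tfrac{\|x\|^2}{\tau},\tfrac{\|x'\|^2}{\tau},\tfrac{x^\top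 x'}{\tau}\big)$ with $\tau=d_{\mathrm{eff}}$ be a continuous positive semi-definite kernel on a set $\mathcal X\subset\mathbb R^{d_n}$ that carries $P_X$, with reproducing kernel Hilbert space $\mathcal H$. For $\lambda>0$ let $\hat f_\lambda\in\mathcal H$ minimise $\sum_i (y_i-f(x_i))^2+\lambda\|f\|_{\mathcal H}^2$, and let $\hat f_0\in\mathcal H$ be the interpolant of the data $(x_i,y_i)$ of minimal norm. Let $\mathbb E_Y\hat f_\lambda$ be the average of $\hat f_\lambda$ over independent $y_i\sim P(Y\mid X=x_i)$, and $\mathbf B(\hat f_\lambda)=\|\mathbb E_Y\hat f_\lambda-f^\star\|^2_{L_2(P_X)}$ the (squared) bias. Here $\lambda=\lambda_n\ge 0$ may depend on $n$. **Assumptions.** (i) In the covariance model there are $\delta,\delta'>0$ with $$g(s,t,u)=\sum_{j=0}^{q} g_j(s,t)\,u^j+u^{q+1}\,r(s,t,u)\qquad\text{for } s,t\in[1-\delta,1+\delta],\ u\in[-\delta',\delta'],$$ where $g_j$ is $(q+1-j)$-times continuously differentiable in a neighbourhood of $(1,1)$ and $r$ is continuous in a neighbourhood of $(1,1,0)$.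 In the spherical model only the restriction of the kernel to the unit sphere needs such an expansion: $g(1,1,u)=\sum_{j=0}^{q}a_ju^j+u^{q+1}r(u)$ for $|u|\le\delta'$, with numbers $a_j$ and with $r$ continuous in a neighbourhood of $0$. (ii) With $K=(k_\tau(x_i,x_j))_{i,j\le n}$ there is a constant $c>0$ such that, almost surely, all eigenvalues of $K+\lambda I_n$ are at least $c$ for all sufficiently large $n$. **Theorem.** Let $m=2\lfloor 2/\beta\rfloor$ in the covariance model and $m=\lfloor 2/\beta\rfloor$ in the spherical model, and let $\mathcal P_{\le m}$ be the space of polynomials on $\mathbb R^{d_n}$ of degree at most $m$. 1. For every $\varepsilon>0$, almost surely, for all sufficiently large $n$, $$\mathbf B(\hat f_\lambda)\ \ge\ \inf_{p\in\mathcal P_{\le m}}\|f^\star-p\|^2_{L_2(P_X)}-\varepsilon .$$ 2. There are polynomials $p=p_{n,\mathbf X}\in\mathcal P_{\le m}$, depending on $n$ and on the data inputs, such that: - for all $\varepsilon,\varepsilon'>0$ there is $C>0$ such that almost surely, for all sufficiently large $n$, with probability at least $1-n^2\exp(-C(\log n)^{1+\varepsilon'})$ over an independent draw $X\sim P_X$,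 $$|\mathbb E_Y\hat f_\lambda(X)-p(X)|\le\varepsilon;$$ - if the kernels $k_\tau$ are bounded on the support of $P_X$ (uniformly in $n$), then almost surely $\|\mathbb E_Y\hat f_\lambda-p\|_{L_2(P_X)}\to 0$ as $n\to\infty$. -/

import Mathlib

open MeasureTheory ProbabilityTheory Filter Topology Matrix
open scoped ENNReal MatrixOrder Matrix.Norms.L2Operator

noncomputable section

namespace PolyBarrier

/-- `d`-dimensional Euclidean space. -/
abbrev E (d : ℕ) : Type := EuclideanSpace ℝ (Fin d)

/-! ### Input distributions -/

/-- The two input models: covariance model, and its projection onto a sphere. -/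
inductive InputModel where
  | cov
  | sphere

/-- Admissible laws of one coordinate of the latent vector `W`: standard normal, or mean zero,
unit variance and supported in `[-R, R]`. -/
def IsEntryLaw (R : ℝ) (ν : Measure ℝ) : Prop :=
  ν = gaussianReal 0 1 ∨
    (IsProbabilityMeasure ν ∧ (∀ᵐ w ∂ν, |w| ≤ R) ∧ ∫ w, w ∂ν = 0 ∧ ∫ w, w ^ 2 ∂ν = 1)

/-- The effective dimension `tr Σ / ‖Σ‖_op`. -/
def effDim {d : ℕ} (S : Matrix (Fin d) (Fin d) ℝ) : ℝ := S.trace / ‖S‖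

/-- The law of `Σ^{1/2} W`, where `W` has i.i.d. entries with law `ν`. -/
def covLaw {d : ℕ} (S : Matrix (Fin d) (Fin d) ℝ) (ν : Measure ℝ) : Measure (E d) :=
  (Measure.pi fun _ : Fin d => ν).map fun w => WithLp.toLp 2 (CFC.sqrt S *ᵥ w)

/-- The law of `√d_eff Z / ‖Z‖` with `Z = Σ^{1/2} W` (and `0` if `Z = 0`). -/
def sphereLaw {d : ℕ} (S : Matrix (Fin d) (Fin d) ℝ) (ν : Measure ℝ) : Measure (E d) :=
  (covLaw S ν).map fun z => (√(effDim S) * ‖z‖⁻¹) • z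

/-- The input law in each of the two models. -/
def inputLaw (model : InputModel) {d : ℕ} (S : Matrix (Fin d) (Fin d) ℝ) (ν : Measure ℝ) :
    Measure (E d) :=
  match model with
  | .cov => covLaw S ν
  | .sphere => sphereLaw S ν

/-! ### Kernels -/

/-- The rotationally invariant kernel `g(‖x‖²/τ, ‖x'‖²/τ, ⟨x, x'⟩/τ)` at scale `τ`. -/
def scaledKernel (g : ℝ → ℝ → ℝ → ℝ) (τ : ℝ) {d : ℕ} (x x' : E d) : ℝ :=
  g (‖x‖ ^ 2 / τ) (‖x'‖ ^ 2 / τ) (inner ℝ x x' / τ)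

/-- Finite expansion of order `q` near the unit sphere: `g(s,t,u) = ∑_{j ≤ q} g_j(s,t) u^j +
u^{q+1} r(s,t,u)` for `s, t` near `1` and `u` near `0`, with `g_j` of class `C^{q+1-j}` in a
neighbourhood of `(1,1)` and `r` continuous in a neighbourhood of `(1,1,0)`. -/
def HasExpansion (q : ℕ) (g : ℝ → ℝ → ℝ → ℝ) : Prop :=
  ∃ δ > 0, ∃ δ' > 0, ∃ (gj : ℕ → ℝ × ℝ → ℝ) (r : ℝ × ℝ × ℝ → ℝ),
    (∀ s ∈ Set.Icc (1 - δ) (1 + δ), ∀ t ∈ Set.Icc (1 - δ) (1 + δ), ∀ u ∈ Set.Icc (-δ') δ',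
      g s t u = ∑ j ∈ Finset.range (q + 1), gj j (s, t) * u ^ j + u ^ (q + 1) * r (s, t, u)) ∧
    (∀ j ≤ q, ∃ U ∈ 𝓝 ((1 : ℝ), (1 : ℝ)), ContDiffOn ℝ ((q + 1 - j : ℕ) : ℕ∞) (gj j) U) ∧
    (∃ U ∈ 𝓝 ((1 : ℝ), (1 : ℝ), (0 : ℝ)), ContinuousOn r U)

/-- The same expansion for the restriction of the kernel to the unit sphere, i.e. only for
`s = t = 1`; the coefficients `g_j(1,1)` are then numbers. -/
def HasSphereExpansion (q : ℕ) (g : ℝ → ℝ → ℝ → ℝ) : Prop :=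
  ∃ δ' > 0, ∃ (a : ℕ → ℝ) (r : ℝ → ℝ),
    (∀ u ∈ Set.Icc (-δ') δ',
      g 1 1 u = ∑ j ∈ Finset.range (q + 1), a j * u ^ j + u ^ (q + 1) * r u) ∧
    (∃ U ∈ 𝓝 (0 : ℝ), ContinuousOn r U)

/-- The kernel, respectively its restriction to the unit sphere, has an expansion of order
`⌊2/β⌋`. -/
def ExpansionAssumption (model : InputModel) (β : ℝ) (g : ℝ → ℝ → ℝ → ℝ) : Prop :=
  match model with
  | .cov => HasExpansion ⌊2 / β⌋₊ g
  | .sphere => HasSphereExpansion ⌊2 / β⌋₊ g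

/-- The degree of the polynomial approximation barrier. -/
def barrierDegree (model : InputModel) (β : ℝ) : ℕ :=
  match model with
  | .cov => 2 * ⌊2 / β⌋₊
  | .sphere => ⌊2 / β⌋₊

/-- Polynomials in `d` variables of (total) degree at most `m`. -/
def polySpace (d m : ℕ) : Set (MvPolynomial (Fin d) ℝ) := {p | p.totalDegree ≤ m}

/-- Evaluation of a polynomial at a point of Euclidean space. -/
def polyEval {d : ℕ} (p : MvPolynomial (Fin d) ℝ) (x : E d) : ℝ :=
  MvPolynomial.eval (fun j => x j) p

/-! ### Estimators -/

section Estimator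

variable {d : ℕ} {𝒳 : Set (E d)} (H : Type*) [NormedAddCommGroup H] [InnerProductSpace ℝ H]
  [RKHS ℝ H 𝒳 ℝ]

/-- `f` is the kernel ridge regression estimate (`lam > 0`), respectively the minimum norm
interpolant (`lam = 0`), for the data `(x i, y i)`. -/
def IsEstimate {n : ℕ} (lam : ℝ) (x : Fin n → 𝒳) (y : Fin n → ℝ) (f : H) : Prop :=
  (0 < lam ∧ ∀ h : H, ∑ i, (y i - f (x i)) ^ 2 + lam * ‖f‖ ^ 2
      ≤ ∑ i, (y i - h (x i)) ^ 2 + lam * ‖h‖ ^ 2) ∨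
  (lam = 0 ∧ (∀ i, f (x i) = y i) ∧ ∀ h : H, (∀ i, h (x i) = y i) → ‖f‖ ≤ ‖h‖)

open Classical in
/-- The kernel estimator; it is `0` if no estimate exists, which can only happen for `lam = 0`
and data that no element of `H` interpolates. -/
def estimator {n : ℕ} (lam : ℝ) (x : Fin n → 𝒳) (y : Fin n → ℝ) : H :=
  if h : ∃ f : H, IsEstimate H lam x y f then h.choose else 0

/-- The estimator averaged over independent responses `y i ∼ P(Y | X = x i)`. -/
def avgEstimator (ρ : Measure (𝒳 × ℝ)) [IsFiniteMeasure ρ] {n : ℕ} (lam : ℝ) (x : Fin n → 𝒳)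
    (z : 𝒳) : ℝ :=
  ∫ y : Fin n → ℝ, estimator H lam x y z ∂(Measure.pi fun i => ρ.condKernel (x i))

end Estimator

/-- The ground truth `f⋆(x) = E[Y | X = x]`. -/
def groundTruth {d : ℕ} {𝒳 : Set (E d)} (ρ : Measure (𝒳 × ℝ)) [IsFiniteMeasure ρ] (x : 𝒳) : ℝ :=
  ∫ y, y ∂(ρ.condKernel x)

/-- The bias `‖E_Y f̂ - f⋆‖²` in `L²(P_X)`, as an extended nonnegative real (it may be infinite). -/
def bias {d : ℕ} {𝒳 : Set (E d)} (H : Type*) [NormedAddCommGroup H] [InnerProductSpace ℝ H]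
    [RKHS ℝ H 𝒳 ℝ] (ρ : Measure (𝒳 × ℝ)) [IsFiniteMeasure ρ] {n : ℕ} (lam : ℝ)
    (x : Fin n → 𝒳) : ℝ≥0∞ :=
  eLpNorm (fun z => avgEstimator H ρ lam x z - groundTruth ρ z) 2 ρ.fst ^ 2

/-- The empirical kernel matrix. -/
def kernelMatrix {d : ℕ} {𝒳 : Set (E d)} (g : ℝ → ℝ → ℝ → ℝ) (τ : ℝ) {n : ℕ} (x : Fin n → 𝒳) :
    Matrix (Fin n) (Fin n) ℝ :=
  Matrix.of fun i j => scaledKernel g τ (x i : E d) (x j : E d)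

end PolyBarrier

end

/-! The averaged estimator is `∑ i, α i * k(x i, ·)` with `α = (K + λ I)⁻¹ f⋆(X)`, by the
representer theorem and linearity in the responses (`estimator_eq`, `avgEstimator_eq`). Since the
eigenvalues are at least `c` and `f⋆` is bounded by `B`, Cauchy–Schwarz gives `∑ |α i| ≤ n B / c`
(`sum_abs_inv_mulVec_le`). It therefore suffices to approximate every function `k(x i, ·)` by a
polynomial with error `o(1/n)`.

In high dimension a fresh input `z` has `‖z‖² / τ` close to `1` and `⟨x i, z⟩ / τ` close to `0`. A
Hanson–Wright inequality (`quadForm_concentration`) and a sub-Gaussian bound for linear forms show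
that both deviations are at most `η = n^(-b)`, outside an event of stretched-exponentially small
probability, as soon as `b < β / 2`. Expanding `g` in powers `u^j (t - 1)^l` with `j + l ≤ q` leaves
an error of order `η^(q+1)` (`exists_polynomial_approx`), and `n η^(q+1) → 0` as soon as `b > 1 / (q
+ 1)`. Such a `b` exists because `q + 1 > 2 / β`. The norm of the data point enters only through the
coefficients, so only the degree in `z` counts: `u` has degree one and `t` degree two, whence `2q`.
On the sphere `t = 1` almost always, no powers of `t - 1` occur, and the degree is `q`.

This proves the approximation with high probability. For `L²` statements the atypical inputs must be
controlled as well: there the polynomial is at most a constant times `n (1 + ‖z‖² / τ)^m`, whose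
moments are bounded up to powers of `n`, and the small probability wins
(`eLpNorm_indicator_compl_le`). For a bounded kernel the estimator is also `O(n)` there. For the
bias no bound on the estimator is needed: on the atypical set one bounds `|f⋆ - p|` directly. That
the data are almost surely typical for all large `n` is Borel–Cantelli
(`ae_eventually_forall_notMem`). -/

noncomputable section

namespace PolyBarrier

/-! ### Exponential moments and Markov bounds -/

/-- `∫⁻ exp f`. -/
def expMoment {α : Type*} [MeasurableSpace α] (P : Measure α) (f : α → ℝ) : ℝ≥0∞ :=
  ∫⁻ x, ENNReal.ofReal (Real.exp (f x)) ∂P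

section General

variable {α : Type*} [MeasurableSpace α] {P : Measure α}

/-- The exponential Markov inequality. -/
lemma measure_ge_le_of_expMoment {f : α → ℝ} (hf : Measurable f) {K : ℝ} {θ : ℝ}
    (hθ : 0 < θ) (h : expMoment P (fun x => θ * f x) ≤ ENNReal.ofReal K) (y : ℝ) :
    P {x | y ≤ f x} ≤ ENNReal.ofReal (K * Real.exp (-(θ * y))) := by
  have hm : Measurable fun x => ENNReal.ofReal (Real.exp (θ * f x)) := by fun_prop
  have h1 := mul_meas_ge_le_lintegral (μ := P) hm (ENNReal.ofReal (Real.exp (θ * y)))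
  have h2 : {x | y ≤ f x} ⊆
      {x | ENNReal.ofReal (Real.exp (θ * y)) ≤ ENNReal.ofReal (Real.exp (θ * f x))} := by
    intro x hx
    exact ENNReal.ofReal_le_ofReal (Real.exp_le_exp.2 (mul_le_mul_of_nonneg_left hx hθ.le))
  have h3 := (mul_le_mul_right (measure_mono (μ := P) h2)
    (ENNReal.ofReal (Real.exp (θ * y)))).trans (h1.trans h)
  have h4 : ENNReal.ofReal (Real.exp (-(θ * y))) * (ENNReal.ofReal (Real.exp (θ * y))) = 1 := by
    rw [← ENNReal.ofReal_mul (Real.exp_pos _).le, ← Real.exp_add]; simp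
  calc P {x | y ≤ f x} = ENNReal.ofReal (Real.exp (-(θ * y))) *
        (ENNReal.ofReal (Real.exp (θ * y)) * P {x | y ≤ f x}) := by
        rw [← mul_assoc, h4, one_mul]
    _ ≤ ENNReal.ofReal (Real.exp (-(θ * y))) * ENNReal.ofReal K := by gcongr
    _ = _ := by rw [← ENNReal.ofReal_mul (Real.exp_pos _).le, mul_comm]

/-- A sub-Gaussian variable has an exponential square moment. -/
lemma expMoment_sq_le [SFinite P] {l : α → ℝ} (hl : Measurable l) {v : ℝ} (hv : 0 < v)
    (h : ∀ t : ℝ, expMoment P (fun x => t * l x) ≤ ENNReal.ofReal (Real.exp (v * t ^ 2 / 2))) :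
    expMoment P (fun x => l x ^ 2 / (4 * v)) ≤ 2 := by
  -- Gaussian linearisation: `exp (l² / (4v))` is, up to `√(π / v)`, the integral over `t` of `exp
  -- (t l - v t²)`. After swapping integrals the hypothesis applies for each `t` and leaves `exp (-v
  -- t² / 2)`, so the actual constant is `√2`.
  have key : ∀ b c : ℝ, 0 < b → ∫⁻ t : ℝ, ENNReal.ofReal (Real.exp (t * c - b * t ^ 2)) =
      ENNReal.ofReal (√(Real.pi / b) * Real.exp (c ^ 2 / (4 * b))) := by
    intro b c hb
    have e1 : ∀ t : ℝ, Real.exp (t * c - b * t ^ 2) =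
        Real.exp (c ^ 2 / (4 * b)) * Real.exp (-b * (t - c / (2 * b)) ^ 2) := by
      intro t
      rw [← Real.exp_add]; congr 1; field_simp; ring
    simp_rw [e1]
    rw [← ofReal_integral_eq_lintegral_ofReal]
    · rw [integral_const_mul, integral_sub_right_eq_self (fun t => Real.exp (-b * t ^ 2)),
        integral_gaussian, mul_comm]
    · exact ((integrable_exp_neg_mul_sq hb).comp_sub_right _).const_mul _
    · exact ae_of_all _ fun t => by positivity
  have hint : ∀ x, ENNReal.ofReal (√(Real.pi / v)) * ENNReal.ofReal (Real.exp (l x ^ 2 / (4 * v))) =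
      ∫⁻ t : ℝ, ENNReal.ofReal (Real.exp (t * l x - v * t ^ 2)) := by
    intro x; rw [key v (l x) hv, ENNReal.ofReal_mul (by positivity)]
  have h2 : ENNReal.ofReal (√(Real.pi / v)) * expMoment P (fun x => l x ^ 2 / (4 * v)) ≤
      ENNReal.ofReal (√(Real.pi / v)) * 2 := by
    unfold expMoment
    rw [← lintegral_const_mul _ (by fun_prop)]
    simp_rw [hint]
    rw [lintegral_lintegral_swap (by fun_prop)]
    calc ∫⁻ t : ℝ, ∫⁻ x, ENNReal.ofReal (Real.exp (t * l x - v * t ^ 2)) ∂P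
        ≤ ∫⁻ t : ℝ, ENNReal.ofReal (Real.exp (t * 0 - (v / 2) * t ^ 2)) := by
          refine lintegral_mono fun t => ?_
          have : ∀ x, ENNReal.ofReal (Real.exp (t * l x - v * t ^ 2)) =
              ENNReal.ofReal (Real.exp (- (v * t ^ 2))) * ENNReal.ofReal (Real.exp (t * l x)) := by
            intro x
            rw [← ENNReal.ofReal_mul (by positivity), ← Real.exp_add]; congr 2; ring
          simp_rw [this]
          rw [lintegral_const_mul _ (by fun_prop)]
          refine (mul_le_mul_right (h t) _).trans ?_
          rw [← ENNReal.ofReal_mul (by positivity), ← Real.exp_add]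
          apply le_of_eq; congr 2; ring
      _ = ENNReal.ofReal (√(Real.pi / (v / 2))) := by
          rw [key (v / 2) 0 (by positivity)]; simp
      _ ≤ ENNReal.ofReal (√(Real.pi / v)) * 2 := by
          rw [show (2 : ℝ≥0∞) = ENNReal.ofReal 2 by simp, ← ENNReal.ofReal_mul (by positivity)]
          apply ENNReal.ofReal_le_ofReal
          rw [Real.sqrt_le_left (by positivity), mul_pow, Real.sq_sqrt (by positivity)]
          have : 0 < Real.pi / v := by positivity
          have e : Real.pi / (v / 2) = 2 * (Real.pi / v) := by field_simp
          rw [e]; nlinarith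
  have h0 : ENNReal.ofReal (√(Real.pi / v)) ≠ 0 := by
    simp; positivity
  exact (ENNReal.mul_le_mul_iff_right h0 (by simp)).1 h2

/-- Sums of squares of sub-Gaussian variables, dependent or not. -/
lemma expMoment_sum_sq_le [IsProbabilityMeasure P] {κ : Type*} [Fintype κ] (l : κ → α → ℝ)
    (hl : ∀ a, Measurable (l a)) (v : κ → ℝ) (hv : ∀ a, 0 ≤ v a)
    (hl0 : ∀ a, v a = 0 → ∀ x, l a x = 0)
    (h : ∀ a, ∀ t : ℝ,
      expMoment P (fun x => t * l a x) ≤ ENNReal.ofReal (Real.exp (v a * t ^ 2 / 2)))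
    {s : ℝ} (hs' : 4 * s * ∑ a, v a ≤ 1) :
    expMoment P (fun x => s * ∑ a, l a x ^ 2) ≤ 2 := by
  set V := ∑ a, v a with hV
  rcases (Finset.sum_nonneg fun a _ => hv a : 0 ≤ V).eq_or_lt' with hV0 | hVpos
  · have : ∀ a x, l a x = 0 := fun a =>
      hl0 a ((Finset.sum_eq_zero_iff_of_nonneg fun a _ => hv a).1 hV0 a (Finset.mem_univ a))
    simp [this, expMoment]
  have hpt : ∀ x, ENNReal.ofReal (Real.exp (s * ∑ a, l a x ^ 2)) ≤
      ∑ a, ENNReal.ofReal (v a / V) * ENNReal.ofReal (Real.exp (l a x ^ 2 / (4 * v a))) := by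
    intro x
    -- Jensen with weights proportional to the variance proxies: convexity replaces independence.
    have hc := convexOn_exp.map_sum_le (t := Finset.univ) (w := fun a => v a / V)
      (p := fun a => l a x ^ 2 / (4 * v a)) (fun a _ => by have := hv a; positivity)
      (by rw [← Finset.sum_div, div_self hVpos.ne']) (by simp)
    simp only [smul_eq_mul] at hc
    calc ENNReal.ofReal (Real.exp (s * ∑ a, l a x ^ 2))
        ≤ ENNReal.ofReal (∑ a, v a / V * Real.exp (l a x ^ 2 / (4 * v a))) := by
          apply ENNReal.ofReal_le_ofReal
          refine le_trans (Real.exp_le_exp.2 ?_) hc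
          rw [Finset.mul_sum]
          refine Finset.sum_le_sum fun a _ => ?_
          rcases (hv a).eq_or_lt' with h0 | hpos
          · simp [hl0 a h0 x]
          · have : v a / V * (l a x ^ 2 / (4 * v a)) = l a x ^ 2 * (1 / (4 * V)) := by
              field_simp
            rw [this, mul_comm]
            gcongr
            rw [le_div_iff₀ (by positivity)]; linarith
      _ = _ := by
          rw [ENNReal.ofReal_sum_of_nonneg]
          · refine Finset.sum_congr rfl fun a _ => ?_
            rw [ENNReal.ofReal_mul (by have := hv a; positivity)]
          · intro a _; have := hv a; positivity
  calc expMoment P (fun x => s * ∑ a, l a x ^ 2)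
      ≤ ∫⁻ x, ∑ a, ENNReal.ofReal (v a / V) *
          ENNReal.ofReal (Real.exp (l a x ^ 2 / (4 * v a))) ∂P := lintegral_mono hpt
    _ = ∑ a, ENNReal.ofReal (v a / V) * expMoment P (fun x => l a x ^ 2 / (4 * v a)) := by
        rw [lintegral_finsetSum _ (fun a _ => by have := hl a; fun_prop)]
        refine Finset.sum_congr rfl fun a _ => ?_
        rw [lintegral_const_mul _ (by have := hl a; fun_prop)]; rfl
    _ ≤ ∑ a, ENNReal.ofReal (v a / V) * 2 := by
        refine Finset.sum_le_sum fun a _ => ?_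
        rcases (hv a).eq_or_lt' with h0 | hpos
        · simp [h0]
        · gcongr; exact expMoment_sq_le (hl a) hpos (h a)
    _ = 2 := by
        rw [← Finset.sum_mul, ← ENNReal.ofReal_sum_of_nonneg
          (fun a _ => by have := hv a; positivity), ← Finset.sum_div, div_self hVpos.ne']
        simp

end General

/-! ### Sub-Gaussian product measures: linear, bilinear and off-diagonal quadratic forms -/

/-- Centred entry laws of unit variance and sub-Gaussian with variance proxy `v`. -/
structure SubGaussianLaw (v : ℝ) (ν : Measure ℝ) : Prop where
  isProb : IsProbabilityMeasure ν
  expMoment_le : ∀ t : ℝ, expMoment ν (fun w => t * w) ≤ ENNReal.ofReal (Real.exp (v * t ^ 2 / 2))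
  integral_sq : ∫ w, w ^ 2 ∂ν = 1

section Product

variable {ι : Type*} [Fintype ι] {v : ℝ} {ν : Measure ℝ}

lemma expMoment_pi_sum [IsProbabilityMeasure ν] (f : ι → ℝ → ℝ) (hf : ∀ i, Measurable (f i)) :
    expMoment (Measure.pi fun _ : ι => ν) (fun w => ∑ i, f i (w i)) =
      ∏ i, expMoment ν (f i) := by
  have h := lintegral_prod_eq_prod_lintegral_of_indepFun (μ := Measure.pi fun _ : ι => ν)
    Finset.univ (fun i w => ENNReal.ofReal (Real.exp (f i (w i))))
    (iIndepFun_pi (μ := fun _ : ι => ν) (X := fun i w => ENNReal.ofReal (Real.exp (f i w)))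
      (fun i => by have := hf i; fun_prop)) (fun i => by have := hf i; fun_prop)
  unfold expMoment
  simp_rw [Real.exp_sum]
  simp_rw [ENNReal.ofReal_prod_of_nonneg (fun i _ => (Real.exp_pos _).le)]
  rw [h]
  refine Finset.prod_congr rfl fun i _ => ?_
  exact (measurePreserving_eval (fun _ : ι => ν) i).lintegral_comp
    (f := fun w => ENNReal.ofReal (Real.exp (f i w))) (by have := hf i; fun_prop)

lemma SubGaussianLaw.expMoment_linear (h : SubGaussianLaw v ν) (a : ι → ℝ) :
    expMoment (Measure.pi fun _ : ι => ν) (fun w => ∑ i, a i * w i) ≤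
      ENNReal.ofReal (Real.exp (v * (∑ i, a i ^ 2) / 2)) := by
  have := h.isProb
  rw [expMoment_pi_sum (fun i w => a i * w) (fun i => by fun_prop)]
  calc ∏ i, expMoment ν (fun w => a i * w)
      ≤ ∏ i, ENNReal.ofReal (Real.exp (v * a i ^ 2 / 2)) :=
        Finset.prod_le_prod' fun i _ => h.expMoment_le _
    _ = _ := by
      rw [← ENNReal.ofReal_prod_of_nonneg (fun i _ => (Real.exp_pos _).le), ← Real.exp_sum,
        Finset.mul_sum, Finset.sum_div]

/-- Each row of `A` gives a linear form that is sub-Gaussian with proxy `v` times its squared norm;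
these forms are dependent, which `expMoment_sum_sq_le` permits. -/
lemma SubGaussianLaw.expMoment_sum_linear_sq (h : SubGaussianLaw v ν) (hv : 0 < v)
    {κ : Type*} [Fintype κ] (A : κ → ι → ℝ) {s : ℝ}
    (hs : 4 * s * (v * ∑ a, ∑ i, A a i ^ 2) ≤ 1) :
    expMoment (Measure.pi fun _ : ι => ν) (fun w => s * ∑ a, (∑ i, A a i * w i) ^ 2) ≤ 2 := by
  have := h.isProb
  have hm : ∀ a, Measurable (fun w : ι → ℝ => ∑ i, A a i * w i) := fun a => by fun_prop
  refine expMoment_sum_sq_le (P := Measure.pi fun _ : ι => ν) (fun a w => ∑ i, A a i * w i) hm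
    (fun a => v * ∑ i, A a i ^ 2) (fun a => by positivity) ?_ ?_ ?_
  · intro a ha w
    have h0 : ∑ i, A a i ^ 2 = 0 := by
      rcases mul_eq_zero.1 ha with h | h
      · exact absurd h hv.ne'
      · exact h
    refine Finset.sum_eq_zero fun i hi => ?_
    have := (Finset.sum_eq_zero_iff_of_nonneg (fun i _ => sq_nonneg (A a i))).1 h0 i hi
    rw [pow_eq_zero_iff two_ne_zero] at this
    simp [this]
  · intro a t
    have h1 : ∀ w : ι → ℝ, t * ∑ i, A a i * w i = ∑ i, t * A a i * w i := fun w => by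
      rw [Finset.mul_sum]; exact Finset.sum_congr rfl fun i _ => by ring
    have h2 : ∑ i, (t * A a i) ^ 2 = t ^ 2 * ∑ i, A a i ^ 2 := by
      rw [Finset.mul_sum]; exact Finset.sum_congr rfl fun i _ => by ring
    have h3 := h.expMoment_linear (fun i => t * A a i)
    rw [h2] at h3
    simp_rw [h1]
    refine h3.trans (le_of_eq ?_)
    congr 2; ring
  · rwa [← Finset.mul_sum]

/-- Bilinear forms in two disjoint groups of coordinates. -/
lemma SubGaussianLaw.expMoment_bilinear (h : SubGaussianLaw v ν) (hv : 0 < v) [DecidableEq ι]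
    (A : ι → ι → ℝ) (I : Finset ι) {θ : ℝ} (hθ : 2 * v ^ 2 * θ ^ 2 * ∑ i, ∑ j, A i j ^ 2 ≤ 1) :
    expMoment (Measure.pi fun _ : ι => ν)
      (fun w => θ * ∑ i ∈ I, ∑ j ∈ Iᶜ, A i j * w i * w j) ≤ 2 := by
  have := h.isProb
  -- With the coordinates outside `I` frozen, the form is linear in those of `I`. Integrating these
  -- out leaves the exponential of a sum of squares of linear forms in the rest, with factor `v θ² /
  -- 2`.
  let f : ({i // i ∈ I} → ℝ) × ({i // ¬ i ∈ I} → ℝ) → ℝ := fun z =>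
    ∑ i : {i // i ∈ I}, (θ * ∑ j : {j // ¬ j ∈ I}, A i j * z.2 j) * z.1 i
  have hf : Measurable f := by fun_prop
  have mp := measurePreserving_piEquivPiSubtypeProd (fun _ : ι => ν) (fun i => i ∈ I)
  have e1 : ∀ w : ι → ℝ, θ * ∑ i ∈ I, ∑ j ∈ Iᶜ, A i j * w i * w j =
      f (MeasurableEquiv.piEquivPiSubtypeProd (fun _ : ι => ℝ) (fun i => i ∈ I) w) := by
    intro w
    have e2 : ∀ i, ∑ j ∈ Iᶜ, A i j * w j = ∑ j : {j // ¬ j ∈ I}, A i j * w j := fun i =>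
      Finset.sum_subtype _ (by simp) (fun j => A i j * w j)
    have e3 : f (MeasurableEquiv.piEquivPiSubtypeProd (fun _ : ι => ℝ) (fun i => i ∈ I) w) =
      ∑ i : {i // i ∈ I}, (θ * ∑ j : {j // ¬ j ∈ I}, A i j * w j) * w i := rfl
    rw [e3, ← Finset.sum_subtype I (fun _ => Iff.rfl)
      (fun i => (θ * ∑ j : {j // ¬ j ∈ I}, A i j * w j) * w i), Finset.mul_sum]
    refine Finset.sum_congr rfl fun i _ => ?_
    rw [← e2, mul_assoc, Finset.sum_mul]
    congr 1
    exact Finset.sum_congr rfl fun j _ => by ring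
  unfold expMoment
  simp_rw [e1]
  rw [mp.lintegral_comp (f := fun z => ENNReal.ofReal (Real.exp (f z))) (by fun_prop),
    lintegral_prod_symm' _ (by fun_prop)]
  have hin : ∀ y : {i // ¬ i ∈ I} → ℝ, ∫⁻ x, ENNReal.ofReal (Real.exp (f (x, y)))
      ∂(Measure.pi fun _ : {i // i ∈ I} => ν) ≤ ENNReal.ofReal (Real.exp
        (v * (∑ i : {i // i ∈ I}, (θ * ∑ j : {j // ¬ j ∈ I}, A i j * y j) ^ 2) / 2)) := by
    intro y
    exact h.expMoment_linear (fun i : {i // i ∈ I} => θ * ∑ j : {j // ¬ j ∈ I}, A i j * y j)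
  refine le_trans (lintegral_mono fun y => le_trans (le_of_eq ?_) (hin y)) ?_
  · congr
    exact Subsingleton.elim _ _
  have := h.expMoment_sum_linear_sq hv (s := v * θ ^ 2 / 2)
    (fun (i : {i // i ∈ I}) (j : {j // ¬ j ∈ I}) => A i j) ?_
  · refine le_trans (le_of_eq ?_) this
    unfold expMoment
    congr 1; ext y; congr 2
    simp_rw [mul_pow, ← Finset.mul_sum]; ring
  · have hsum : ∑ a : {i // i ∈ I}, ∑ i : {j // ¬ j ∈ I}, A a i ^ 2 ≤ ∑ i, ∑ j, A i j ^ 2 := by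
      rw [← Finset.sum_subtype I (fun _ => Iff.rfl)
        (fun i => ∑ j : {j // ¬ j ∈ I}, A i j ^ 2)]
      refine (Finset.sum_le_univ_sum_of_nonneg fun i => by positivity).trans ?_
      refine Finset.sum_le_sum fun i _ => ?_
      rw [← Finset.sum_subtype Iᶜ (by simp) (fun j => A i j ^ 2)]
      exact Finset.sum_le_univ_sum_of_nonneg fun j => by positivity
    refine le_trans (le_of_eq ?_) (le_trans (mul_le_mul_of_nonneg_left hsum
      (show 0 ≤ 2 * v ^ 2 * θ ^ 2 by positivity)) hθ)
    ring

/-- Toggling the membership of `i` or of `j` permutes the subsets, so the four membership patterns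
of the pair are equally frequent. -/
lemma four_mul_sum_ite_mem_notMem [DecidableEq ι] {i j : ι} (hij : i ≠ j) :
    4 * ∑ I : Finset ι, (if i ∈ I ∧ j ∉ I then (1 : ℝ) else 0) = 2 ^ Fintype.card ι := by
  let tog (k : ι) : Finset ι ≃ Finset ι :=
    ⟨fun I => symmDiff I {k}, fun I => symmDiff I {k}, fun I => by simp, fun I => by simp⟩
  have m1 : ∀ (k : ι) (I : Finset ι), k ∈ tog k I ↔ k ∉ I := by
    intro k I; simp [tog, Finset.mem_symmDiff]
  have m2 : ∀ (k l : ι) (I : Finset ι), l ≠ k → (l ∈ tog k I ↔ l ∈ I) := by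
    intro k l I h; simp [tog, Finset.mem_symmDiff, h]
  have s1 : ∑ I : Finset ι, (if i ∈ I ∧ j ∉ I then (1 : ℝ) else 0) =
      ∑ I : Finset ι, (if i ∈ I ∧ j ∈ I then (1 : ℝ) else 0) := by
    rw [← (tog j).sum_comp]
    refine Finset.sum_congr rfl fun I _ => ?_
    simp only [m1, m2 j i I hij, not_not]
  have s2 : ∑ I : Finset ι, (if i ∈ I then (1 : ℝ) else 0) =
      ∑ I : Finset ι, (if i ∉ I then (1 : ℝ) else 0) := by
    rw [← (tog i).sum_comp]
    refine Finset.sum_congr rfl fun I _ => ?_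
    simp only [m1]
  have s3 : ∑ I : Finset ι, (if i ∈ I then (1 : ℝ) else 0) +
      ∑ I : Finset ι, (if i ∉ I then (1 : ℝ) else 0) = 2 ^ Fintype.card ι := by
    rw [← Finset.sum_add_distrib]
    have : ∀ I : Finset ι, (if i ∈ I then (1 : ℝ) else 0) + (if i ∉ I then (1 : ℝ) else 0) = 1 := by
      intro I; split_ifs <;> simp
    rw [Finset.sum_congr rfl fun I _ => this I]
    simp
  have s4 : ∑ I : Finset ι, (if i ∈ I ∧ j ∉ I then (1 : ℝ) else 0) +
      ∑ I : Finset ι, (if i ∈ I ∧ j ∈ I then (1 : ℝ) else 0) =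
      ∑ I : Finset ι, (if i ∈ I then (1 : ℝ) else 0) := by
    rw [← Finset.sum_add_distrib]
    refine Finset.sum_congr rfl fun I _ => ?_
    by_cases hi : i ∈ I <;> by_cases hj : j ∈ I <;> simp [hi, hj]
  linarith

/-- Off-diagonal quadratic forms, by decoupling. -/
lemma SubGaussianLaw.expMoment_offDiag (h : SubGaussianLaw v ν) (hv : 0 < v) [DecidableEq ι]
    (A : ι → ι → ℝ) {θ : ℝ} (hθ : 32 * v ^ 2 * θ ^ 2 * ∑ i, ∑ j, A i j ^ 2 ≤ 1) :
    expMoment (Measure.pi fun _ : ι => ν)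
      (fun w => θ * ∑ i, ∑ j, if i ≠ j then A i j * w i * w j else 0) ≤ 2 := by
  set N : ℝ := 2 ^ Fintype.card ι with hN
  have hNpos : 0 < N := by positivity
  let off (I : Finset ι) (w : ι → ℝ) : ℝ := ∑ i ∈ I, ∑ j ∈ Iᶜ, A i j * w i * w j
  have hoff : ∀ I, Measurable (off I) := fun I => by fun_prop
  -- Decoupling: a uniformly random subset `I` separates a given ordered pair with probability
  -- `1/4`. Jensen then reduces to bilinear forms at parameter `4θ`, which turns the `2` of
  -- `expMoment_bilinear` into `32`.
  have hid : ∀ w : ι → ℝ, (∑ i, ∑ j, if i ≠ j then A i j * w i * w j else 0) =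
      ∑ I : Finset ι, (1 / N) * (4 * off I w) := by
    intro w
    have e1 : ∀ I, off I w = ∑ i, ∑ j, (if i ∈ I ∧ j ∉ I then 1 else 0) * (A i j * w i * w j) := by
      intro I
      simp only [off]
      rw [← Finset.sum_filter_add_sum_filter_not (Finset.univ : Finset ι) (fun i => i ∈ I)]
      rw [Finset.sum_eq_zero (s := (Finset.univ : Finset ι).filter fun i => ¬ i ∈ I), add_zero]
      · rw [Finset.filter_univ_mem]
        refine Finset.sum_congr rfl fun i hi => ?_
        rw [← Finset.sum_filter_add_sum_filter_not (Finset.univ : Finset ι) (fun j => j ∈ Iᶜ)]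
        rw [Finset.sum_eq_zero (s := (Finset.univ : Finset ι).filter fun i => ¬ i ∈ Iᶜ), add_zero]
        · rw [Finset.filter_univ_mem]
          refine Finset.sum_congr rfl fun j hj => ?_
          rw [if_pos ⟨hi, Finset.mem_compl.1 hj⟩, one_mul]
        · intro j hj
          rw [if_neg, zero_mul]
          simp at hj; tauto
      · intro i hi
        simp at hi
        simp [hi]
    simp_rw [e1, ← Finset.mul_sum]
    have e2 : ∑ I : Finset ι, ∑ i, ∑ j, (if i ∈ I ∧ j ∉ I then 1 else 0) * (A i j * w i * w j) =
        ∑ i, ∑ j, ∑ I : Finset ι, (if i ∈ I ∧ j ∉ I then 1 else 0) * (A i j * w i * w j) := by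
      rw [Finset.sum_comm]
      exact Finset.sum_congr rfl fun i _ => Finset.sum_comm
    rw [e2, Finset.mul_sum, Finset.mul_sum]
    refine Finset.sum_congr rfl fun i _ => ?_
    rw [Finset.mul_sum, Finset.mul_sum]
    refine Finset.sum_congr rfl fun j _ => ?_
    rw [← Finset.sum_mul]
    split_ifs with hij
    · have := four_mul_sum_ite_mem_notMem hij
      rw [← hN] at this
      rw [← mul_assoc, ← mul_assoc, mul_assoc (1 / N), this]
      field_simp
    · have : i = j := by simpa using hij
      subst this
      simp
  have hcard : ∑ _I : Finset ι, (1 / N) = 1 := by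
    simp [hN]
  calc expMoment (Measure.pi fun _ : ι => ν)
        (fun w => θ * ∑ i, ∑ j, if i ≠ j then A i j * w i * w j else 0)
      ≤ ∫⁻ w, ∑ I : Finset ι, ENNReal.ofReal (1 / N) *
          ENNReal.ofReal (Real.exp ((4 * θ) * off I w)) ∂(Measure.pi fun _ : ι => ν) := by
        refine lintegral_mono fun w => ?_
        have hc := convexOn_exp.map_sum_le (t := Finset.univ) (w := fun _ : Finset ι => 1 / N)
          (p := fun I => (4 * θ) * off I w) (fun a _ => by positivity) hcard (by simp)
        simp only [smul_eq_mul] at hc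
        simp_rw [← ENNReal.ofReal_mul (show 0 ≤ 1 / N by positivity)]
        rw [← ENNReal.ofReal_sum_of_nonneg (fun a _ => by positivity)]
        apply ENNReal.ofReal_le_ofReal
        refine le_trans (le_of_eq ?_) hc
        rw [hid w, Finset.mul_sum]
        congr 1
        refine Finset.sum_congr rfl fun I _ => ?_
        ring
    _ = ∑ I : Finset ι, ENNReal.ofReal (1 / N) *
          expMoment (Measure.pi fun _ : ι => ν) (fun w => (4 * θ) * off I w) := by
        rw [lintegral_finsetSum _ (fun I _ => by have := hoff I; fun_prop)]
        refine Finset.sum_congr rfl fun I _ => ?_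
        rw [lintegral_const_mul _ (by have := hoff I; fun_prop)]; rfl
    _ ≤ ∑ I : Finset ι, ENNReal.ofReal (1 / N) * 2 := by
        gcongr with I
        exact h.expMoment_bilinear hv A I (le_trans (le_of_eq (by ring)) hθ)
    _ = 2 := by
        rw [← Finset.sum_mul, ← ENNReal.ofReal_sum_of_nonneg (fun a _ => by positivity), hcard]
        simp

end Product

/-! ### Centred squares and a Hanson–Wright inequality -/

lemma exp_le_one_add_add_sq_mul_exp_abs (x : ℝ) :
    Real.exp x ≤ 1 + x + x ^ 2 * Real.exp |x| := by
  have h1 : 1 ≤ Real.exp |x| := Real.one_le_exp (abs_nonneg x)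
  rcases le_or_gt |x| 1 with hx | hx
  · have := (abs_le.1 (Real.abs_exp_sub_one_sub_id_le hx)).2
    nlinarith [sq_nonneg x]
  · rcases lt_abs.1 hx with h | h
    · rw [abs_of_pos (by linarith)] at *
      nlinarith [mul_le_mul_of_nonneg_right (show 1 ≤ x ^ 2 by nlinarith) (Real.exp_pos x).le]
    · have : Real.exp x ≤ 1 := Real.exp_le_one_iff.2 (by linarith)
      nlinarith [mul_le_mul_of_nonneg_left h1 (sq_nonneg x)]

section Square

variable {v : ℝ} {ν : Measure ℝ}

lemma SubGaussianLaw.integral_exp_sq_le (h : SubGaussianLaw v ν) (hv : 0 < v) :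
    Integrable (fun w => Real.exp (w ^ 2 / (4 * v))) ν ∧
      ∫ w, Real.exp (w ^ 2 / (4 * v)) ∂ν ≤ 2 := by
  have := h.isProb
  have h1 : ∫⁻ w, ENNReal.ofReal (Real.exp (w ^ 2 / (4 * v))) ∂ν ≤ 2 :=
    expMoment_sq_le (l := fun w => w) measurable_id hv h.expMoment_le
  have hi : Integrable (fun w => Real.exp (w ^ 2 / (4 * v))) ν := by
    refine (lintegral_ofReal_ne_top_iff_integrable (by fun_prop)
      (ae_of_all _ fun w => (Real.exp_pos _).le)).1 ?_
    exact ne_top_of_le_ne_top (by simp) h1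
  refine ⟨hi, ?_⟩
  rw [← ofReal_integral_eq_lintegral_ofReal hi (ae_of_all _ fun w => (Real.exp_pos _).le)] at h1
  have h2 : ENNReal.ofReal (∫ w, Real.exp (w ^ 2 / (4 * v)) ∂ν) ≤ ENNReal.ofReal 2 := by
    simpa using h1
  exact (ENNReal.ofReal_le_ofReal_iff (by norm_num)).1 h2

/-- Constant in the exponential moment bound for a centred square. -/
def squareConst (v : ℝ) : ℝ := 256 * v ^ 2 * Real.exp (1 / (4 * v))

/-- Expand `exp` to second order: the linear term integrates to zero because the second moment is
`1`, and the remainder, of size `s²`, is controlled by `E exp (w² / (4v)) ≤ 2`. -/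
lemma SubGaussianLaw.expMoment_centered_sq (h : SubGaussianLaw v ν) (hv : 0 < v) {s : ℝ}
    (hs : |s| ≤ 1 / (8 * v)) :
    expMoment ν (fun w => s * (w ^ 2 - 1)) ≤ ENNReal.ofReal (Real.exp (squareConst v * s ^ 2)) := by
  have := h.isProb
  obtain ⟨hi, h2⟩ := h.integral_exp_sq_le hv
  set D : ℝ := 128 * v ^ 2 * Real.exp (1 / (4 * v)) with hD
  have hpt : ∀ w : ℝ, Real.exp (s * (w ^ 2 - 1)) ≤
      1 + s * (w ^ 2 - 1) + D * s ^ 2 * Real.exp (w ^ 2 / (4 * v)) := by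
    intro w
    refine (exp_le_one_add_add_sq_mul_exp_abs _).trans ?_
    refine add_le_add le_rfl ?_
    set y := w ^ 2 + 1 with hy
    have hy0 : 0 ≤ y := by positivity
    have ha1 : |w ^ 2 - 1| ≤ y := by rw [abs_le]; constructor <;> nlinarith [sq_nonneg w]
    have ha : |s * (w ^ 2 - 1)| ≤ y / (8 * v) := by
      rw [abs_mul]
      calc |s| * |w ^ 2 - 1| ≤ 1 / (8 * v) * y := by gcongr
        _ = _ := by ring
    -- From `u² / 2 ≤ exp u` at `u = y / (8v)`; together with the factor `exp |s (w² - 1)| ≤ exp (y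
    -- / (8v))` this exactly uses up the available exponent `w² / (4v)`.
    have hq : y ^ 2 ≤ 128 * v ^ 2 * Real.exp (y / (8 * v)) := by
      have := Real.quadratic_le_exp_of_nonneg (show 0 ≤ y / (8 * v) by positivity)
      have h0 : 0 ≤ y / (8 * v) := by positivity
      have e : y ^ 2 = 128 * v ^ 2 * ((y / (8 * v)) ^ 2 / 2) := by field_simp; ring
      rw [e]
      gcongr
      linarith
    have hs2 : (s * (w ^ 2 - 1)) ^ 2 ≤ s ^ 2 * y ^ 2 := by
      rw [mul_pow]; gcongr ?_ * ?_
      exact sq_le_sq' (by linarith [(abs_le.1 ha1).1]) (abs_le.1 ha1).2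
    calc (s * (w ^ 2 - 1)) ^ 2 * Real.exp |s * (w ^ 2 - 1)|
        ≤ (s ^ 2 * (128 * v ^ 2 * Real.exp (y / (8 * v)))) * Real.exp (y / (8 * v)) := by
          gcongr
          exact hs2.trans (by gcongr)
      _ = s ^ 2 * (128 * v ^ 2) * (Real.exp (y / (8 * v)) * Real.exp (y / (8 * v))) := by ring
      _ = s ^ 2 * (128 * v ^ 2) * (Real.exp (1 / (4 * v)) * Real.exp (w ^ 2 / (4 * v))) := by
          rw [← Real.exp_add, ← Real.exp_add]; congr 2; rw [hy]; field_simp; ring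
      _ = _ := by rw [hD]; ring
  -- Otherwise the Bochner integral of the square would be `0` by convention, not `1`.
  have hsq : Integrable (fun w : ℝ => w ^ 2) ν := by
    by_contra hc
    have := h.integral_sq
    rw [integral_undef hc] at this
    norm_num at this
  have hsc : Integrable (fun w : ℝ => s * (w ^ 2 - 1)) ν :=
    (hsq.sub (integrable_const 1)).const_mul s
  have hR1 : Integrable (fun w : ℝ => 1 + s * (w ^ 2 - 1)) ν := (integrable_const 1).add hsc
  have hR2 : Integrable (fun w : ℝ => D * s ^ 2 * Real.exp (w ^ 2 / (4 * v))) ν := hi.const_mul _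
  have hint : ∫ w, (1 + s * (w ^ 2 - 1) + D * s ^ 2 * Real.exp (w ^ 2 / (4 * v))) ∂ν =
      1 + D * s ^ 2 * ∫ w, Real.exp (w ^ 2 / (4 * v)) ∂ν := by
    rw [integral_add hR1 hR2, integral_add (integrable_const 1) hsc, integral_const_mul,
      integral_sub hsq (integrable_const 1), h.integral_sq, integral_const_mul]
    simp
  calc expMoment ν (fun w => s * (w ^ 2 - 1))
      ≤ ∫⁻ w, ENNReal.ofReal
          (1 + s * (w ^ 2 - 1) + D * s ^ 2 * Real.exp (w ^ 2 / (4 * v))) ∂ν :=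
        lintegral_mono fun w => ENNReal.ofReal_le_ofReal (hpt w)
    _ = ENNReal.ofReal (1 + D * s ^ 2 * ∫ w, Real.exp (w ^ 2 / (4 * v)) ∂ν) := by
        rw [← hint]
        exact (ofReal_integral_eq_lintegral_ofReal (hR1.add hR2)
          (ae_of_all _ fun w => (Real.exp_pos _).le.trans (hpt w))).symm
    _ ≤ _ := by
        apply ENNReal.ofReal_le_ofReal
        have hD0 : 0 ≤ D * s ^ 2 := by positivity
        calc 1 + D * s ^ 2 * ∫ w, Real.exp (w ^ 2 / (4 * v)) ∂ν ≤ squareConst v * s ^ 2 + 1 := by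
              have := mul_le_mul_of_nonneg_left h2 hD0
              have e : squareConst v * s ^ 2 = D * s ^ 2 * 2 := by rw [squareConst, hD]; ring
              linarith
          _ ≤ _ := Real.add_one_le_exp _

variable {ι : Type*} [Fintype ι]

lemma SubGaussianLaw.expMoment_diag (h : SubGaussianLaw v ν) (hv : 0 < v) (a : ι → ℝ) {θ : ℝ}
    (hθ : ∀ i, |θ * a i| ≤ 1 / (8 * v)) :
    expMoment (Measure.pi fun _ : ι => ν) (fun w => θ * ∑ i, a i * (w i ^ 2 - 1)) ≤
      ENNReal.ofReal (Real.exp (squareConst v * (θ ^ 2 * ∑ i, a i ^ 2))) := by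
  have := h.isProb
  have e : ∀ w : ι → ℝ, θ * ∑ i, a i * (w i ^ 2 - 1) = ∑ i, (θ * a i) * (w i ^ 2 - 1) := by
    intro w; rw [Finset.mul_sum]; exact Finset.sum_congr rfl fun i _ => by ring
  simp_rw [e]
  rw [expMoment_pi_sum (fun i w => (θ * a i) * (w ^ 2 - 1)) (fun i => by fun_prop)]
  calc ∏ i, expMoment ν (fun w => (θ * a i) * (w ^ 2 - 1))
      ≤ ∏ i, ENNReal.ofReal (Real.exp (squareConst v * (θ * a i) ^ 2)) :=
        Finset.prod_le_prod' fun i _ => h.expMoment_centered_sq hv (hθ i)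
    _ = _ := by
      rw [← ENNReal.ofReal_prod_of_nonneg (fun i _ => (Real.exp_pos _).le), ← Real.exp_sum]
      congr 2
      simp_rw [mul_pow, ← Finset.mul_sum]

/-- Constant in the concentration inequality for quadratic forms. -/
def quadConst (v : ℝ) : ℝ := 8 + 4 * Real.exp (squareConst v / (64 * v ^ 2))

/-- A Hanson--Wright type inequality: the quadratic form of a matrix with small entries on the
diagonal concentrates around its trace. -/
lemma SubGaussianLaw.quadForm_concentration (h : SubGaussianLaw v ν) (hv : 0 < v)
    (A : ι → ι → ℝ) {τ : ℝ} (hτ : 1 ≤ τ) (hdiag : ∀ i, |A i i| ≤ 1) (htr : ∑ i, A i i = τ)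
    (hF : ∑ i, ∑ j, A i j ^ 2 ≤ τ) (x : ℝ) :
    (Measure.pi fun _ : ι => ν) {w | x * √τ ≤ |∑ i, ∑ j, A i j * w i * w j - τ|} ≤
      ENNReal.ofReal (quadConst v * Real.exp (-(x / (16 * v)))) := by
  classical
  have hτ0 : 0 < τ := by linarith
  have hsq : 0 < √τ := Real.sqrt_pos.2 hτ0
  have hsq1 : 1 ≤ √τ := Real.one_le_sqrt.2 hτ
  have hsq2 : √τ ^ 2 = τ := Real.sq_sqrt hτ0.le
  set P := Measure.pi fun _ : ι => ν
  set K := Real.exp (squareConst v / (64 * v ^ 2)) with hK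
  set off : (ι → ℝ) → ℝ := fun w => ∑ i, ∑ j, if i ≠ j then A i j * w i * w j else 0 with hoff
  set dia : (ι → ℝ) → ℝ := fun w => ∑ i, A i i * (w i ^ 2 - 1) with hdia
  have hoffm : Measurable off := by
    refine Finset.measurable_fun_sum _ fun i _ => Finset.measurable_fun_sum _ fun j _ => ?_
    split_ifs <;> fun_prop
  have hdiam : Measurable dia := by fun_prop
  have hdec : ∀ w : ι → ℝ, ∑ i, ∑ j, A i j * w i * w j - τ = off w + dia w := by
    intro w
    have e : ∀ i, ∑ j, A i j * w i * w j =
        (∑ j, if i ≠ j then A i j * w i * w j else 0) + A i i * w i ^ 2 := by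
      intro i
      have : ∀ j, A i j * w i * w j = (if i ≠ j then A i j * w i * w j else 0) +
          (if i = j then A i j * w i * w j else 0) := by
        intro j; by_cases hij : i = j <;> simp [hij]
      rw [Finset.sum_congr rfl fun j _ => this j, Finset.sum_add_distrib]
      simp [sq, mul_assoc]
    simp_rw [e, hoff, hdia, Finset.sum_add_distrib, mul_sub, Finset.sum_sub_distrib, mul_one, htr]
    ring
  -- The scale `1 / √τ` keeps `θ²` times the squared Frobenius norm bounded; since `τ ≥ 1`, it also
  -- meets the bound on `|θ A i i|` needed for the diagonal part.
  set θ : ℝ := 1 / (8 * v * √τ) with hθ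
  have hθ0 : 0 < θ := by positivity
  have hθ2 : θ ^ 2 = 1 / (64 * v ^ 2 * τ) := by
    rw [hθ, div_pow, mul_pow, hsq2]; ring
  have hF0 : 0 ≤ ∑ i, ∑ j, A i j ^ 2 := by positivity
  have hoffθ : 32 * v ^ 2 * θ ^ 2 * ∑ i, ∑ j, A i j ^ 2 ≤ 1 := by
    rw [hθ2]
    calc 32 * v ^ 2 * (1 / (64 * v ^ 2 * τ)) * ∑ i, ∑ j, A i j ^ 2
        ≤ 32 * v ^ 2 * (1 / (64 * v ^ 2 * τ)) * τ := by gcongr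
      _ = 1 / 2 := by field_simp; norm_num
      _ ≤ 1 := by norm_num
  have hdF : ∑ i, A i i ^ 2 ≤ τ := by
    refine le_trans (Finset.sum_le_sum fun i _ => ?_) hF
    exact Finset.single_le_sum (f := fun j => A i j ^ 2) (fun j _ => sq_nonneg _)
      (Finset.mem_univ i)
  have hCs : 0 ≤ squareConst v := by unfold squareConst; positivity
  have hdθ : ∀ i, |θ * A i i| ≤ 1 / (8 * v) := by
    intro i
    rw [abs_mul, abs_of_pos hθ0]
    calc θ * |A i i| ≤ θ * 1 := by gcongr; exact hdiag i
      _ ≤ 1 / (8 * v) := by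
        rw [mul_one, hθ]
        apply one_div_le_one_div_of_le (by positivity)
        nlinarith
  have hKb : Real.exp (squareConst v * (θ ^ 2 * ∑ i, A i i ^ 2)) ≤ K := by
    rw [hK]
    apply Real.exp_le_exp.2
    rw [div_eq_mul_one_div]
    gcongr
    rw [hθ2]
    calc 1 / (64 * v ^ 2 * τ) * ∑ i, A i i ^ 2 ≤ 1 / (64 * v ^ 2 * τ) * τ := by gcongr
      _ = _ := by field_simp
  have two : (2 : ℝ≥0∞) = ENNReal.ofReal 2 := by simp
  set y := x * √τ / 2 with hy
  have hθy : θ * y = x / (16 * v) := by rw [hθ, hy]; field_simp; ring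
  have b1 : P {w | y ≤ off w} ≤ ENNReal.ofReal (2 * Real.exp (-(x / (16 * v)))) := by
    rw [← hθy]
    exact measure_ge_le_of_expMoment hoffm hθ0 (two ▸ h.expMoment_offDiag hv A hoffθ) y
  have b2 : P {w | y ≤ -off w} ≤ ENNReal.ofReal (2 * Real.exp (-(x / (16 * v)))) := by
    rw [← hθy]
    refine measure_ge_le_of_expMoment hoffm.neg hθ0 ?_ y
    have := h.expMoment_offDiag hv A (θ := -θ) (by rwa [neg_sq])
    rw [two] at this
    convert this using 3
    simp only [Pi.neg_apply]; ring
  have b3 : P {w | y ≤ dia w} ≤ ENNReal.ofReal (K * Real.exp (-(x / (16 * v)))) := by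
    rw [← hθy]
    exact measure_ge_le_of_expMoment hdiam hθ0
      ((h.expMoment_diag hv _ hdθ).trans (ENNReal.ofReal_le_ofReal hKb)) y
  have b4 : P {w | y ≤ -dia w} ≤ ENNReal.ofReal (K * Real.exp (-(x / (16 * v)))) := by
    rw [← hθy]
    refine measure_ge_le_of_expMoment hdiam.neg hθ0 ?_ y
    have := h.expMoment_diag hv (fun i => A i i) (θ := -θ)
      (fun i => by rw [neg_mul, abs_neg]; exact hdθ i)
    rw [neg_sq] at this
    refine le_trans (le_of_eq ?_) (this.trans (ENNReal.ofReal_le_ofReal hKb))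
    congr 1; ext w; simp only [Pi.neg_apply, hdia]; ring
  have hsub : {w | x * √τ ≤ |∑ i, ∑ j, A i j * w i * w j - τ|} ⊆
      ({w | y ≤ off w} ∪ {w | y ≤ -off w}) ∪ ({w | y ≤ dia w} ∪ {w | y ≤ -dia w}) := by
    intro w hw
    simp only [Set.mem_ofPred_eq, hdec] at hw
    simp only [Set.mem_union, Set.mem_ofPred_eq]
    by_contra! hcon
    obtain ⟨⟨c1, c2⟩, c3, c4⟩ := hcon
    have : |off w + dia w| < x * √τ := by
      rw [abs_lt]; constructor <;> linarith
    linarith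
  have hE := Real.exp_pos (-(x / (16 * v)))
  have hK0 : 0 < K := Real.exp_pos _
  calc P {w | x * √τ ≤ |∑ i, ∑ j, A i j * w i * w j - τ|}
      ≤ (P {w | y ≤ off w} + P {w | y ≤ -off w}) + (P {w | y ≤ dia w} + P {w | y ≤ -dia w}) :=
        (measure_mono hsub).trans ((measure_union_le _ _).trans
          (add_le_add (measure_union_le _ _) (measure_union_le _ _)))
    _ ≤ (ENNReal.ofReal (2 * Real.exp (-(x / (16 * v)))) +
          ENNReal.ofReal (2 * Real.exp (-(x / (16 * v))))) +
        (ENNReal.ofReal (K * Real.exp (-(x / (16 * v)))) +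
          ENNReal.ofReal (K * Real.exp (-(x / (16 * v))))) := by gcongr
    _ ≤ _ := by
        rw [← ENNReal.ofReal_add (by positivity) (by positivity),
          ← ENNReal.ofReal_add (by positivity) (by positivity),
          ← ENNReal.ofReal_add (by positivity) (by positivity)]
        apply ENNReal.ofReal_le_ofReal
        rw [quadConst, ← hK]
        nlinarith [mul_pos hK0 hE]

end Square

/-! ### The admissible entry laws are sub-Gaussian -/

/-- Hoeffding's lemma gives proxy `R²` in the bounded case. The maximum with `1` covers the Gaussian
case and makes one proxy valid for all sample sizes. -/
lemma IsEntryLaw.subGaussianLaw {R : ℝ} {ν : Measure ℝ} (h : IsEntryLaw R ν) :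
    SubGaussianLaw (max 1 (R ^ 2)) ν := by
  have mono : ∀ {c : ℝ}, c ≤ max 1 (R ^ 2) → HasSubgaussianMGF (fun w : ℝ => w) c.toNNReal ν →
      0 ≤ c → ∀ t : ℝ, expMoment ν (fun w => t * w) ≤
        ENNReal.ofReal (Real.exp (max 1 (R ^ 2) * t ^ 2 / 2)) := by
    intro c hc hs hc0 t
    unfold expMoment
    rw [← ofReal_integral_eq_lintegral_ofReal (hs.integrable_exp_mul t)
      (ae_of_all _ fun w => (Real.exp_pos _).le)]
    apply ENNReal.ofReal_le_ofReal
    refine (hs.mgf_le t).trans (Real.exp_le_exp.2 ?_)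
    rw [Real.coe_toNNReal _ hc0]
    gcongr
  rcases h with rfl | ⟨hp, hR, h1, h2⟩
  · refine ⟨inferInstance, mono (c := 1) (le_max_left _ _) ?_ zero_le_one, ?_⟩
    · refine ⟨fun t => integrable_exp_mul_gaussianReal t, fun t => ?_⟩
      rw [mgf_fun_id_gaussianReal]; simp
    · have := variance_fun_id_gaussianReal (μ := 0) (v := 1)
      rw [variance_of_integral_eq_zero (by fun_prop) (by simp)] at this
      simpa using this
  · refine ⟨hp, mono (c := R ^ 2) (le_max_right _ _) ?_ (sq_nonneg R), h2⟩
    have := hasSubgaussianMGF_of_mem_Icc_of_integral_eq_zero (μ := ν) (X := fun w : ℝ => w)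
      (a := -R) (b := R) (by fun_prop)
      (by filter_upwards [hR] with w hw using abs_le.1 hw) h1
    convert this using 1
    rw [sub_neg_eq_add, ← two_mul, nnnorm_mul]
    ext
    simp [Real.coe_toNNReal _ (sq_nonneg R)]

/-! ### The covariance matrix and its square root -/

section Matrix

variable {d : ℕ} {S : Matrix (Fin d) (Fin d) ℝ}

lemma sqrt_mul_sqrt_self (hS : S.PosSemidef) : CFC.sqrt S * CFC.sqrt S = S :=
  CFC.sqrt_mul_sqrt_self S hS.nonneg

lemma isHermitian_sqrt : (CFC.sqrt S).IsHermitian :=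
  (CFC.sqrt_nonneg S).isSelfAdjoint

lemma transpose_sqrt : (CFC.sqrt S)ᵀ = CFC.sqrt S := by
  simpa [Matrix.conjTranspose_eq_transpose_of_trivial] using (isHermitian_sqrt (S := S)).eq

lemma norm_sqrt_eq_one (hS : S.PosSemidef) (h1 : ‖S‖ = 1) : ‖CFC.sqrt S‖ = 1 := by
  have h : ‖CFC.sqrt S‖ * ‖CFC.sqrt S‖ = 1 := by
    rw [← h1]
    nth_rewrite 3 [← sqrt_mul_sqrt_self hS]
    have := CStarRing.norm_star_mul_self (x := CFC.sqrt S)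
    rw [(CFC.sqrt_nonneg S).isSelfAdjoint.star_eq] at this
    exact this.symm
  nlinarith [norm_nonneg (CFC.sqrt S)]

lemma sum_sqrt_mulVec_sq_le (hS : S.PosSemidef) (h1 : ‖S‖ = 1) (a : Fin d → ℝ) :
    ∑ i, (CFC.sqrt S *ᵥ a) i ^ 2 ≤ ∑ i, a i ^ 2 := by
  have h := Matrix.l2_opNorm_mulVec (CFC.sqrt S) (WithLp.toLp 2 a)
  rw [norm_sqrt_eq_one hS h1, one_mul] at h
  have h2 := pow_le_pow_left₀ (norm_nonneg _) h 2
  rw [EuclideanSpace.real_norm_sq_eq, EuclideanSpace.real_norm_sq_eq] at h2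
  exact h2

lemma sum_sqrt_mulVec_sq (hS : S.PosSemidef) (w : Fin d → ℝ) :
    ∑ i, (CFC.sqrt S *ᵥ w) i ^ 2 = ∑ i, ∑ j, S i j * w i * w j := by
  have e : ∑ i, (CFC.sqrt S *ᵥ w) i ^ 2 = (CFC.sqrt S *ᵥ w) ⬝ᵥ (CFC.sqrt S *ᵥ w) := by
    simp [dotProduct, sq]
  rw [e, Matrix.dotProduct_mulVec, Matrix.vecMul_mulVec, transpose_sqrt, sqrt_mul_sqrt_self hS,
    ← Matrix.dotProduct_mulVec]
  simp only [dotProduct, mulVec, Finset.mul_sum]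
  exact Finset.sum_congr rfl fun i _ => Finset.sum_congr rfl fun j _ => by ring

lemma sum_sqrt_sq (hS : S.PosSemidef) : ∑ i, ∑ j, CFC.sqrt S i j ^ 2 = S.trace := by
  nth_rewrite 2 [← sqrt_mul_sqrt_self hS]
  rw [Matrix.trace]
  refine Finset.sum_congr rfl fun i _ => ?_
  rw [Matrix.diag_apply, Matrix.mul_apply]
  refine Finset.sum_congr rfl fun j _ => ?_
  have : CFC.sqrt S j i = CFC.sqrt S i j := by
    conv_lhs => rw [← transpose_sqrt, Matrix.transpose_apply]
  rw [this, sq]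

lemma sum_sqrt_row_sq (hS : S.PosSemidef) (i : Fin d) : ∑ j, CFC.sqrt S j i ^ 2 = S i i := by
  conv_rhs => rw [← sqrt_mul_sqrt_self hS]
  rw [Matrix.mul_apply]
  refine Finset.sum_congr rfl fun j _ => ?_
  have : CFC.sqrt S i j = CFC.sqrt S j i := by
    conv_lhs => rw [← transpose_sqrt, Matrix.transpose_apply]
  rw [this, sq]

/-- A column of `S` is the contraction `√S` applied to the same column of `√S`, whose squared norm
is a diagonal entry of `S`. -/
lemma sum_sq_le_trace (hS : S.PosSemidef) (h1 : ‖S‖ = 1) : ∑ i, ∑ j, S i j ^ 2 ≤ S.trace := by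
  rw [Finset.sum_comm, Matrix.trace]
  refine Finset.sum_le_sum fun i _ => ?_
  rw [Matrix.diag_apply, ← sum_sqrt_row_sq hS i]
  refine le_trans (le_of_eq ?_) (sum_sqrt_mulVec_sq_le hS h1 (fun j => CFC.sqrt S j i))
  refine Finset.sum_congr rfl fun j _ => ?_
  conv_lhs => rw [← sqrt_mul_sqrt_self hS]
  rw [Matrix.mul_apply]; rfl

lemma abs_diag_le_one (h1 : ‖S‖ = 1) (i : Fin d) : |S i i| ≤ 1 := by
  have h := Matrix.l2_opNorm_mulVec S (WithLp.toLp 2 (Pi.single i 1))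
  rw [h1, one_mul] at h
  have h2 := pow_le_pow_left₀ (norm_nonneg _) h 2
  rw [EuclideanSpace.real_norm_sq_eq, EuclideanSpace.real_norm_sq_eq] at h2
  have e1 : ∑ j, (Pi.single i (1 : ℝ) : Fin d → ℝ) j ^ 2 = 1 := by
    rw [Finset.sum_eq_single i] <;> simp +contextual
  have e2 : ∑ j, S j i ^ 2 ≤ 1 := by
    refine le_trans (le_of_eq ?_) (h2.trans_eq e1)
    refine Finset.sum_congr rfl fun j _ => ?_
    simp
  have e3 : S i i ^ 2 ≤ ∑ j, S j i ^ 2 :=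
    Finset.single_le_sum (f := fun j => S j i ^ 2) (fun j _ => sq_nonneg _) (Finset.mem_univ i)
  rw [← sq_le_one_iff_abs_le_one]; linarith

lemma effDim_eq_trace (h1 : ‖S‖ = 1) : effDim S = S.trace := by rw [effDim, h1, div_one]

end Matrix

/-! ### Concentration and moments of the input law -/

section Laws

variable {d : ℕ} {S : Matrix (Fin d) (Fin d) ℝ} {v : ℝ} {ν : Measure ℝ}

lemma measurable_sqrt_mulVec :
    Measurable fun w : Fin d → ℝ => (WithLp.toLp 2 (CFC.sqrt S *ᵥ w) : E d) := by
  refine (WithLp.measurable_toLp 2 _).comp ?_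
  exact (Continuous.matrix_mulVec continuous_const continuous_id).measurable

lemma covLaw_apply {s : Set (E d)} (hs : MeasurableSet s) : covLaw S ν s =
    (Measure.pi fun _ : Fin d => ν) {w | (WithLp.toLp 2 (CFC.sqrt S *ᵥ w) : E d) ∈ s} :=
  Measure.map_apply measurable_sqrt_mulVec hs

lemma isProbabilityMeasure_covLaw (h : SubGaussianLaw v ν) :
    IsProbabilityMeasure (covLaw S ν) := by
  have := h.isProb
  exact Measure.isProbabilityMeasure_map measurable_sqrt_mulVec.aemeasurable

lemma expMoment_covLaw {f : E d → ℝ} (hf : Measurable f) : expMoment (covLaw S ν) f =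
    expMoment (Measure.pi fun _ : Fin d => ν) fun w => f (WithLp.toLp 2 (CFC.sqrt S *ᵥ w)) :=
  lintegral_map (by fun_prop) measurable_sqrt_mulVec

/-- Hanson–Wright with the matrix `S` itself, since `‖√S w‖² = wᵀ S w`. Operator norm one bounds the
diagonal by `1` and the squared Frobenius norm by the trace, which is the effective dimension. -/
lemma covLaw_norm_sq_concentration (hS : S.PosSemidef) (h1 : ‖S‖ = 1) (h : SubGaussianLaw v ν)
    (hv : 0 < v) (hτ : 1 ≤ effDim S) (x : ℝ) :
    covLaw S ν {z | x * √(effDim S) ≤ |‖z‖ ^ 2 - effDim S|} ≤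
      ENNReal.ofReal (quadConst v * Real.exp (-(x / (16 * v)))) := by
  have hm : MeasurableSet {z : E d | x * √(effDim S) ≤ |‖z‖ ^ 2 - effDim S|} :=
    measurableSet_le (by fun_prop) (by fun_prop)
  rw [covLaw_apply hm]
  have he := effDim_eq_trace h1
  have := h.quadForm_concentration hv S hτ (abs_diag_le_one h1) he.symm
    ((sum_sq_le_trace hS h1).trans he.ge) x
  refine le_trans (le_of_eq ?_) this
  congr 1; ext w
  have e : ‖(WithLp.toLp 2 (CFC.sqrt S *ᵥ w) : E d)‖ ^ 2 = ∑ i, ∑ j, S i j * w i * w j := by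
    rw [EuclideanSpace.real_norm_sq_eq, ← sum_sqrt_mulVec_sq hS]
  simp only [Set.mem_ofPred_eq, e]

/-- Moving `√S` to the other side, `⟨a, √S w⟩` is a linear form in `w` with coefficient vector `√S
a`, of norm at most `‖a‖`. -/
lemma covLaw_inner_tail (hS : S.PosSemidef) (h1 : ‖S‖ = 1) (h : SubGaussianLaw v ν)
    (hv : 0 < v) (a : E d) {L : ℝ} (hL : 0 < L) (ha : ‖a‖ ≤ L) (x : ℝ) :
    covLaw S ν {z | x * L ≤ |inner ℝ a z|} ≤
      ENNReal.ofReal (2 * Real.exp (v / 2) * Real.exp (-x)) := by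
  have hlin : ∀ b : E d, ‖b‖ ≤ L → expMoment (covLaw S ν) (fun z => 1 / L * inner ℝ b z) ≤
      ENNReal.ofReal (Real.exp (v / 2)) := by
    intro b hb
    rw [expMoment_covLaw (by fun_prop)]
    have e : ∀ w : Fin d → ℝ, 1 / L * inner ℝ b (WithLp.toLp 2 (CFC.sqrt S *ᵥ w) : E d) =
        ∑ i, (1 / L * (CFC.sqrt S *ᵥ b.ofLp) i) * w i := by
      intro w
      simp_rw [mul_assoc, ← Finset.mul_sum]
      congr 1
      have : inner ℝ b (WithLp.toLp 2 (CFC.sqrt S *ᵥ w) : E d) =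
          b.ofLp ⬝ᵥ (CFC.sqrt S *ᵥ w) := by
        rw [EuclideanSpace.inner_eq_star_dotProduct]; simp [dotProduct_comm]
      rw [this, Matrix.dotProduct_mulVec, ← Matrix.mulVec_transpose, transpose_sqrt]
      rfl
    simp_rw [e]
    refine (h.expMoment_linear _).trans (ENNReal.ofReal_le_ofReal (Real.exp_le_exp.2 ?_))
    simp_rw [mul_pow, ← Finset.mul_sum]
    have h2 := sum_sqrt_mulVec_sq_le hS h1 b.ofLp
    rw [← EuclideanSpace.real_norm_sq_eq] at h2
    have h3 : ‖b‖ ^ 2 ≤ L ^ 2 := pow_le_pow_left₀ (norm_nonneg _) hb 2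
    have h4 : (1 / L) ^ 2 * ∑ i, (CFC.sqrt S *ᵥ b.ofLp) i ^ 2 ≤ 1 := by
      calc (1 / L) ^ 2 * ∑ i, (CFC.sqrt S *ᵥ b.ofLp) i ^ 2 ≤ (1 / L) ^ 2 * L ^ 2 := by
            gcongr; exact h2.trans h3
        _ = 1 := by field_simp
    nlinarith
  have t1 : ∀ b : E d, ‖b‖ ≤ L → covLaw S ν {z | x * L ≤ inner ℝ b z} ≤
      ENNReal.ofReal (Real.exp (v / 2) * Real.exp (-x)) := by
    intro b hb
    have := measure_ge_le_of_expMoment (f := fun z : E d => inner ℝ b z) (by fun_prop)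
      (show 0 < 1 / L by positivity) (hlin b hb) (x * L)
    rwa [show 1 / L * (x * L) = x by field_simp] at this
  have hsub : {z : E d | x * L ≤ |inner ℝ a z|} ⊆
      {z | x * L ≤ inner ℝ a z} ∪ {z | x * L ≤ inner ℝ (-a) z} := by
    intro z hz
    rcases le_abs.1 (show x * L ≤ |inner ℝ a z| from hz) with h | h
    · exact Or.inl h
    · right; simpa [inner_neg_left] using h
  refine (measure_mono hsub).trans ((measure_union_le _ _).trans
    ((add_le_add (t1 a ha) (t1 (-a) (by rwa [norm_neg]))).trans (le_of_eq ?_)))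
  rw [← ENNReal.ofReal_add (by positivity) (by positivity)]
  congr 1; ring

lemma expMoment_covLaw_norm_sq (hS : S.PosSemidef) (h1 : ‖S‖ = 1) (h : SubGaussianLaw v ν)
    (hv : 0 < v) (hτ : 0 < effDim S) :
    expMoment (covLaw S ν) (fun z => ‖z‖ ^ 2 / effDim S / (4 * v)) ≤ 2 := by
  rw [expMoment_covLaw (by fun_prop)]
  have := h.expMoment_sum_linear_sq hv (fun i j => (CFC.sqrt S) i j) (s := 1 / (4 * v * effDim S)) (by
    rw [sum_sqrt_sq hS, ← effDim_eq_trace h1]; apply le_of_eq; field_simp)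
  refine le_trans (le_of_eq ?_) this
  congr 1; ext w
  rw [EuclideanSpace.real_norm_sq_eq]
  simp only [mulVec, dotProduct]
  field_simp

/-- The values of `‖x‖² / τ` considered typical in the two models. -/
def NormGood (model : InputModel) (η t : ℝ) : Prop :=
  match model with
  | .cov => |t - 1| ≤ η
  | .sphere => t = 1

lemma NormGood.abs_sub_one_le {model : InputModel} {η t : ℝ} (h : NormGood model η t)
    (hη : 0 ≤ η) : |t - 1| ≤ η := by
  cases model
  · exact h
  · have : t = 1 := h
    simpa [this]

lemma NormGood.mono {model : InputModel} {η η' t : ℝ} (h : NormGood model η t) (hη : η ≤ η') :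
    NormGood model η' t := by
  cases model
  · exact le_trans (show |t - 1| ≤ η from h) hη
  · exact h

lemma measurableSet_normGood (model : InputModel) (η : ℝ) : MeasurableSet {t | NormGood model η t} := by
  cases model
  · exact measurableSet_le (f := fun t : ℝ => |t - 1|) (by fun_prop) measurable_const
  · exact measurableSet_singleton (1 : ℝ)

lemma measurable_sphere_proj :
    Measurable fun z : E d => (√(effDim S) * ‖z‖⁻¹) • z := by fun_prop

lemma norm_sphere_proj_sq (hτ : 0 < effDim S) {z : E d} (hz : z ≠ 0) :
    ‖(√(effDim S) * ‖z‖⁻¹) • z‖ ^ 2 / effDim S = 1 := by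
  have : 0 < ‖z‖ := norm_pos_iff.2 hz
  rw [norm_smul, Real.norm_of_nonneg (by positivity), mul_assoc, inv_mul_cancel₀ this.ne', mul_one,
    Real.sq_sqrt hτ.le, div_self hτ.ne']

lemma norm_sphere_proj_sq_le (hτ : 0 < effDim S) (z : E d) :
    ‖(√(effDim S) * ‖z‖⁻¹) • z‖ ^ 2 / effDim S ≤ 1 := by
  by_cases hz : z = 0
  · simp [hz]
  · exact (norm_sphere_proj_sq hτ hz).le

/-- The norm of an input concentrates. -/
lemma inputLaw_not_normGood (model : InputModel) (hS : S.PosSemidef) (h1 : ‖S‖ = 1)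
    (h : SubGaussianLaw v ν) (hv : 0 < v) (hτ : 1 ≤ effDim S) {η : ℝ} (hη : η ≤ 1) :
    inputLaw model S ν {z | ¬ NormGood model η (‖z‖ ^ 2 / effDim S)} ≤
      ENNReal.ofReal (quadConst v * Real.exp (-(η * √(effDim S) / (16 * v)))) := by
  have hτ0 : 0 < effDim S := by linarith
  have hsq : √(effDim S) * √(effDim S) = effDim S := Real.mul_self_sqrt hτ0.le
  have hq : 0 ≤ quadConst v := by unfold quadConst; positivity
  cases model
  · refine (measure_mono ?_).trans
      (covLaw_norm_sq_concentration hS h1 h hv hτ (η * √(effDim S)))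
    intro z hz
    have hz' : η < |‖z‖ ^ 2 / effDim S - 1| := not_le.1 hz
    have e : ‖z‖ ^ 2 / effDim S - 1 = (‖z‖ ^ 2 - effDim S) / effDim S := by field_simp
    rw [e, abs_div, abs_of_pos hτ0, lt_div_iff₀ hτ0] at hz'
    show η * √(effDim S) * √(effDim S) ≤ _
    rw [mul_assoc, hsq]; exact hz'.le
  · have hm : MeasurableSet {z : E d | ¬ NormGood .sphere η (‖z‖ ^ 2 / effDim S)} :=
      (measurableSet_normGood .sphere η).compl.preimage
        (show Measurable fun z : E d => ‖z‖ ^ 2 / effDim S by fun_prop)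
    show sphereLaw S ν _ ≤ _
    rw [sphereLaw, Measure.map_apply measurable_sphere_proj hm]
    refine ((measure_mono ?_).trans
      (covLaw_norm_sq_concentration hS h1 h hv hτ (√(effDim S)))).trans ?_
    · intro z hz
      -- The projected vector has norm exactly `√τ` unless `z = 0`, and then `|‖z‖² - τ| = τ = √τ *
      -- √τ`, a far larger deviation than needed since `η ≤ 1`.
      have : z = 0 := by
        by_contra hz0
        exact hz (norm_sphere_proj_sq hτ0 hz0)
      show √(effDim S) * √(effDim S) ≤ _
      rw [hsq, this]; simp [abs_of_pos hτ0]
    · apply ENNReal.ofReal_le_ofReal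
      gcongr
      nlinarith [Real.sqrt_nonneg (effDim S)]

/-- A linear form of an input is small. -/
lemma inputLaw_inner_tail (model : InputModel) (hS : S.PosSemidef) (h1 : ‖S‖ = 1)
    (h : SubGaussianLaw v ν) (hv : 1 ≤ v) (hτ : 1 ≤ effDim S) (a : E d)
    (ha : ‖a‖ ^ 2 ≤ 2 * effDim S) {η : ℝ} (hη0 : 0 ≤ η) (hη : η ≤ 1) :
    inputLaw model S ν {z | η < |inner ℝ a z / effDim S|} ≤
      ENNReal.ofReal ((2 * Real.exp (v / 2) + quadConst v) *
        Real.exp (-(η * √(effDim S) / (32 * v)))) := by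
  have hv0 : 0 < v := by linarith
  have hτ0 : 0 < effDim S := by linarith
  set τ := effDim S with hτdef
  have hsqpos : 0 < √τ := Real.sqrt_pos.2 hτ0
  have hsq : √τ * √τ = τ := Real.mul_self_sqrt hτ0.le
  have hq : 0 ≤ quadConst v := by unfold quadConst; positivity
  have haL : ‖a‖ ≤ 2 * √τ := by
    rw [← Real.sqrt_sq (norm_nonneg a)]
    refine Real.sqrt_le_iff.2 ⟨by positivity, ?_⟩
    rw [mul_pow, sq √τ, hsq]; nlinarith
  have key : ∀ s : ℝ, covLaw S ν {z | s * τ ≤ |inner ℝ a z|} ≤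
      ENNReal.ofReal (2 * Real.exp (v / 2) * Real.exp (-(s * √τ / 2))) := by
    intro s
    have := covLaw_inner_tail hS h1 h hv0 a (L := 2 * √τ) (by positivity) haL (s * √τ / 2)
    rwa [show s * √τ / 2 * (2 * √τ) = s * (√τ * √τ) by ring, hsq] at this
  have hx : 0 ≤ η * √τ := by positivity
  cases model
  · refine ((measure_mono ?_).trans (key η)).trans (ENNReal.ofReal_le_ofReal ?_)
    · intro z hz
      have hz' : η < |inner ℝ a z / τ| := hz
      rw [abs_div, abs_of_pos hτ0, lt_div_iff₀ hτ0] at hz'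
      exact hz'.le
    · have h3 : η * √τ / (32 * v) ≤ η * √τ / 2 :=
        div_le_div_of_nonneg_left hx (by norm_num) (by linarith)
      exact mul_le_mul (by linarith) (Real.exp_le_exp.2 (neg_le_neg h3)) (Real.exp_pos _).le
        (by positivity)
  · have hm : MeasurableSet {z : E d | η < |inner ℝ a z / τ|} :=
      measurableSet_lt measurable_const (by fun_prop)
    show sphereLaw S ν _ ≤ _
    rw [sphereLaw, Measure.map_apply measurable_sphere_proj hm]
    -- Either `‖z‖ ≥ √τ / 2`, and the projection at most doubles the inner product, or the norm is
    -- atypically small.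
    have hsub : (fun z : E d => (√(effDim S) * ‖z‖⁻¹) • z) ⁻¹' {z : E d | η < |inner ℝ a z / τ|} ⊆
        {z | (η / 2) * τ ≤ |inner ℝ a z|} ∪ {z | (√τ / 2) * √τ ≤ |‖z‖ ^ 2 - τ|} := by
      intro z hz
      have hz' : η < |inner ℝ a ((√τ * ‖z‖⁻¹) • z) / τ| := hz
      rw [inner_smul_right, abs_div, abs_of_pos hτ0, lt_div_iff₀ hτ0, abs_mul,
        abs_of_nonneg (by positivity)] at hz'
      by_cases hc : √τ / 2 ≤ ‖z‖
      · left
        have hzpos : 0 < ‖z‖ := by linarith [half_pos hsqpos]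
        have : √τ * ‖z‖⁻¹ ≤ 2 := by
          rw [← div_eq_mul_inv, div_le_iff₀ hzpos]; linarith
        have := mul_le_mul_of_nonneg_right this (abs_nonneg (inner ℝ a z))
        show η / 2 * τ ≤ |inner ℝ a z|
        linarith
      · right
        push Not at hc
        show √τ / 2 * √τ ≤ |‖z‖ ^ 2 - τ|
        have : ‖z‖ ^ 2 ≤ τ / 4 := by nlinarith [norm_nonneg z]
        rw [abs_of_nonpos (by linarith)]
        linarith
    refine ((measure_mono hsub).trans (measure_union_le _ _)).trans ?_
    refine (add_le_add (key (η / 2)) (covLaw_norm_sq_concentration hS h1 h hv0 hτ _)).trans ?_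
    rw [← ENNReal.ofReal_add (by positivity) (by positivity), add_mul]
    apply ENNReal.ofReal_le_ofReal
    have h3 : η * √τ / (32 * v) ≤ η / 2 * √τ / 2 := by
      rw [show η / 2 * √τ / 2 = η * √τ / 4 by ring]
      exact div_le_div_of_nonneg_left hx (by norm_num) (by linarith)
    have h4 : η * √τ / (32 * v) ≤ √τ / 2 / (16 * v) := by
      rw [show √τ / 2 / (16 * v) = √τ / (32 * v) by field_simp; norm_num]
      gcongr
      nlinarith
    exact add_le_add
      (mul_le_mul_of_nonneg_left (Real.exp_le_exp.2 (neg_le_neg h3)) (by positivity))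
      (mul_le_mul_of_nonneg_left (Real.exp_le_exp.2 (neg_le_neg h4)) hq)

/-- Bound for the moments of `1 + ‖x‖² / τ`. -/
def momentConst (v : ℝ) (k : ℕ) : ℝ :=
  2 * (k.factorial * (4 * v) ^ k * Real.exp (1 / (4 * v))) + 2 ^ k

/-- Powers are dominated by the exponential moment of `‖z‖² / τ` in the covariance model, while on
the sphere `1 + ‖z‖² / τ ≤ 2`; `momentConst` adds the two bounds. It does not depend on the
dimension. -/
lemma lintegral_inputLaw_pow_le (model : InputModel) (hS : S.PosSemidef) (h1 : ‖S‖ = 1)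
    (h : SubGaussianLaw v ν) (hv : 0 < v) (hτ : 0 < effDim S) (k : ℕ) :
    ∫⁻ z, ENNReal.ofReal ((1 + ‖z‖ ^ 2 / effDim S) ^ k) ∂(inputLaw model S ν) ≤
      ENNReal.ofReal (momentConst v k) := by
  have := isProbabilityMeasure_covLaw (S := S) h
  set D := (k.factorial * (4 * v) ^ k * Real.exp (1 / (4 * v))) with hD
  have hD0 : 0 ≤ D := by positivity
  cases model
  · have hpt : ∀ z : E d, ENNReal.ofReal ((1 + ‖z‖ ^ 2 / effDim S) ^ k) ≤
        ENNReal.ofReal D * ENNReal.ofReal (Real.exp (‖z‖ ^ 2 / effDim S / (4 * v))) := by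
      intro z
      rw [← ENNReal.ofReal_mul hD0]
      apply ENNReal.ofReal_le_ofReal
      have h2 := Real.pow_div_factorial_le_exp ((1 + ‖z‖ ^ 2 / effDim S) / (4 * v))
        (by positivity) k
      rw [div_le_iff₀ (by positivity), div_pow, div_le_iff₀ (by positivity), add_div,
        Real.exp_add] at h2
      refine h2.trans (le_of_eq ?_)
      rw [hD]; ring
    calc ∫⁻ z, ENNReal.ofReal ((1 + ‖z‖ ^ 2 / effDim S) ^ k) ∂(covLaw S ν)
        ≤ ENNReal.ofReal D *
            expMoment (covLaw S ν) (fun z => ‖z‖ ^ 2 / effDim S / (4 * v)) := by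
          rw [expMoment, ← lintegral_const_mul _ (by fun_prop)]
          exact lintegral_mono hpt
      _ ≤ ENNReal.ofReal D * ENNReal.ofReal 2 := by
          gcongr
          simpa using expMoment_covLaw_norm_sq hS h1 h hv hτ
      _ ≤ _ := by
          rw [← ENNReal.ofReal_mul hD0]
          apply ENNReal.ofReal_le_ofReal
          rw [momentConst, ← hD]
          have : (0 : ℝ) ≤ 2 ^ k := by positivity
          linarith
  · show ∫⁻ z, ENNReal.ofReal ((1 + ‖z‖ ^ 2 / effDim S) ^ k) ∂(sphereLaw S ν) ≤ _
    rw [sphereLaw, lintegral_map (by fun_prop) measurable_sphere_proj]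
    calc ∫⁻ z, ENNReal.ofReal ((1 + ‖(√(effDim S) * ‖z‖⁻¹) • z‖ ^ 2 / effDim S) ^ k) ∂(covLaw S ν)
        ≤ ∫⁻ _z, ENNReal.ofReal (2 ^ k) ∂(covLaw S ν) := by
          refine lintegral_mono fun z => ENNReal.ofReal_le_ofReal ?_
          have := norm_sphere_proj_sq_le hτ z
          gcongr
          linarith
      _ = ENNReal.ofReal (2 ^ k) := by simp
      _ ≤ _ := by
          apply ENNReal.ofReal_le_ofReal
          rw [momentConst]
          linarith

end Laws

/-! ### Polynomial approximation of the kernel function -/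

/-- Taylor expansion in the second variable, locally uniformly in the first one. -/
lemma exists_taylor_second (m : ℕ) : ∀ F : ℝ × ℝ → ℝ, ContDiffAt ℝ (m : ℕ∞) F (1, 1) →
    ∃ (a : ℕ → ℝ → ℝ) (C : ℝ), 0 ≤ C ∧ ∀ᶠ δ : ℝ in 𝓝[>] 0, ∀ s, |s - 1| ≤ δ →
      (∀ l < m, |a l s| ≤ C) ∧ ∀ t, |t - 1| ≤ δ →
        |F (s, t) - ∑ l ∈ Finset.range m, a l s * (t - 1) ^ l| ≤ C * |t - 1| ^ m := by
  have box : ∀ p : ℝ × ℝ → Prop, (∀ᶠ x in 𝓝 ((1 : ℝ), (1 : ℝ)), p x) →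
      ∀ᶠ δ : ℝ in 𝓝[>] 0, ∀ s, |s - 1| ≤ δ → ∀ t, |t - 1| ≤ δ → p (s, t) := by
    intro p hp
    obtain ⟨ε, hε, h⟩ := Metric.eventually_nhds_iff.1 hp
    filter_upwards [Ioo_mem_nhdsGT hε] with δ hδ s hs t ht
    apply h
    rw [Prod.dist_eq, max_lt_iff, Real.dist_eq, Real.dist_eq]
    exact ⟨hs.trans_lt hδ.2, ht.trans_lt hδ.2⟩
  have bdd : ∀ F : ℝ × ℝ → ℝ, ContinuousAt F (1, 1) →
      ∀ᶠ x in 𝓝 ((1 : ℝ), (1 : ℝ)), |F x| ≤ |F (1, 1)| + 1 := by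
    intro F hF
    filter_upwards [hF.abs.eventually (gt_mem_nhds (lt_add_one _))] with x hx using hx.le
  induction m with
  | zero =>
    intro F hF
    refine ⟨fun _ _ => 0, |F (1, 1)| + 1, by positivity, ?_⟩
    filter_upwards [box _ (bdd F hF.continuousAt)] with δ hδ s hs
    exact ⟨by simp, fun t ht => by simpa using hδ s hs t ht⟩
  | succ m ih =>
    intro F hF
    -- Induction on the order: expand the partial derivative in the second variable and integrate
    -- the expansion. The coefficients need only be bounded in `s`, never differentiated.
    have hd : ContDiffAt ℝ (m : ℕ∞) (fun p => fderiv ℝ F p (0, 1)) (1, 1) :=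
      (hF.fderiv_right (m := (m : ℕ∞)) (by norm_cast)).clm_apply contDiffAt_const
    obtain ⟨a, C, hC, hev⟩ := ih _ hd
    have hdiff : ∀ᶠ x in 𝓝 ((1 : ℝ), (1 : ℝ)), DifferentiableAt ℝ F x := by
      have h1 : ContDiffAt ℝ (1 : ℕ∞) F (1, 1) := hF.of_le (by norm_cast; omega)
      filter_upwards [h1.eventually (by simp)] with x hx using hx.differentiableAt (by simp)
    refine ⟨fun l s => Nat.casesOn l (F (s, 1)) (fun l => a l s / (l + 1)),
      C + (|F (1, 1)| + 1), by positivity, ?_⟩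
    filter_upwards [hev, box _ hdiff, box _ (bdd F hF.continuousAt), self_mem_nhdsWithin]
      with δ h1 h2 h3 hδ s hs
    have hδ0 : 0 < δ := hδ
    obtain ⟨ha, hrem⟩ := h1 s hs
    refine ⟨?_, ?_⟩
    · rintro (_ | l) hl
      · have := h3 s hs 1 (by simpa using hδ0.le)
        show |F (s, 1)| ≤ _
        linarith
      · show |a l s / (l + 1)| ≤ _
        have := ha l (by omega)
        rw [abs_div, abs_of_pos (show (0 : ℝ) < l + 1 by positivity)]
        have h4 : |a l s| / (l + 1) ≤ |a l s| :=
          div_le_self (abs_nonneg _) (by linarith [(Nat.cast_nonneg l : (0 : ℝ) ≤ l)])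
        have := abs_nonneg (F (1, 1))
        linarith
    · intro t ht
      -- `D` omits the constant term `F (s, 1)`, which the difference `D t - D 1` supplies; its
      -- derivative is the remainder of order `m`, and the mean value inequality gains one power.
      set D : ℝ → ℝ := fun t => F (s, t) -
        ∑ l ∈ Finset.range m, a l s / (l + 1) * (t - 1) ^ (l + 1) with hD
      have hsum : F (s, t) - ∑ l ∈ Finset.range (m + 1),
          (Nat.casesOn l (F (s, 1)) (fun l => a l s / (l + 1)) : ℝ) * (t - 1) ^ l =
          D t - D 1 := by
        rw [Finset.sum_range_succ']
        simp [hD]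
        ring
      rw [hsum]
      have hsub : ∀ y ∈ Set.uIcc 1 t, |y - 1| ≤ |t - 1| := by
        intro y hy
        exact Set.abs_sub_left_of_mem_uIcc hy
      have hder : ∀ y ∈ Set.uIcc 1 t, HasDerivWithinAt D (fderiv ℝ F (s, y) (0, 1) -
          ∑ l ∈ Finset.range m, a l s * (y - 1) ^ l) (Set.uIcc 1 t) y := by
        intro y hy
        have hy' := (hsub y hy).trans ht
        have e1 : HasDerivAt (fun y => F (s, y)) (fderiv ℝ F (s, y) (0, 1)) y :=
          (h2 s hs y hy').hasFDerivAt.comp_hasDerivAt y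
            ((hasDerivAt_const y s).prodMk (hasDerivAt_id y))
        have e2 : ∀ l ∈ Finset.range m, HasDerivAt
            (fun y : ℝ => a l s / (l + 1) * (y - 1) ^ (l + 1)) (a l s * (y - 1) ^ l) y := by
          intro l _
          have h5 : (l : ℝ) + 1 ≠ 0 := by positivity
          have h6 := (((hasDerivAt_id y).sub_const 1).pow (l + 1)).const_mul (a l s / (l + 1))
          refine HasDerivAt.congr_deriv h6 ?_
          simp only [id, Nat.cast_add, Nat.cast_one, Nat.add_sub_cancel, mul_one]
          field_simp
        exact (e1.sub (HasDerivAt.fun_sum e2)).hasDerivWithinAt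
      have hbd : ∀ y ∈ Set.uIcc 1 t, ‖fderiv ℝ F (s, y) (0, 1) -
          ∑ l ∈ Finset.range m, a l s * (y - 1) ^ l‖ ≤ C * |t - 1| ^ m := by
        intro y hy
        refine (hrem y ((hsub y hy).trans ht)).trans ?_
        have := hsub y hy
        gcongr
      have := (convex_uIcc 1 t).norm_image_sub_le_of_norm_hasDerivWithin_le hder hbd
        Set.left_mem_uIcc Set.right_mem_uIcc
      rw [Real.norm_eq_abs, Real.norm_eq_abs] at this
      refine this.trans ?_
      rw [pow_succ, ← mul_assoc]
      gcongr
      have := abs_nonneg (F (1, 1))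
      linarith

/-- Polynomial approximations, in the last two variables, of the function `g` defining the
kernel. -/
lemma exists_polynomial_approx (model : InputModel) (β : ℝ) {g : ℝ → ℝ → ℝ → ℝ}
    (hg : ExpansionAssumption model β g) :
    ∃ (I : Finset ((_ : ℕ) × ℕ)) (a : ((_ : ℕ) × ℕ) → ℝ → ℝ) (C : ℝ), 0 ≤ C ∧
      (∀ e ∈ I, e.1 + 2 * e.2 ≤ barrierDegree model β) ∧
      ∀ᶠ δ : ℝ in 𝓝[>] 0,
        (∀ e ∈ I, ∀ s, |s - 1| ≤ δ → |a e s| ≤ C) ∧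
        ∀ η, 0 ≤ η → η ≤ δ → ∀ s t u, NormGood model δ s → NormGood model η t → |u| ≤ η →
          |g s t u - ∑ e ∈ I, a e s * (u ^ e.1 * (t - 1) ^ e.2)| ≤ C * η ^ (⌊2 / β⌋₊ + 1) := by
  set q := ⌊2 / β⌋₊ with hq
  cases model
  · obtain ⟨δ, hδ, δ', hδ', gj, r, hexp, hgj, U, hU, hr⟩ := hg
    rw [← hq] at hexp hgj
    have htay : ∀ j : ℕ, ∃ (a : ℕ → ℝ → ℝ) (C : ℝ), 0 ≤ C ∧ (j ≤ q → ∀ᶠ δ : ℝ in 𝓝[>] 0,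
        ∀ s, |s - 1| ≤ δ → (∀ l < q + 1 - j, |a l s| ≤ C) ∧ ∀ t, |t - 1| ≤ δ →
        |gj j (s, t) - ∑ l ∈ Finset.range (q + 1 - j), a l s * (t - 1) ^ l| ≤
          C * |t - 1| ^ (q + 1 - j)) := by
      intro j
      by_cases hj : j ≤ q
      · obtain ⟨V, hV, hc⟩ := hgj j hj
        obtain ⟨a, C, hC, h⟩ := exists_taylor_second (q + 1 - j) (gj j) (hc.contDiffAt hV)
        exact ⟨a, C, hC, fun _ => h⟩
      · exact ⟨fun _ _ => 0, 0, le_rfl, fun h => absurd h hj⟩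
    choose a C hC ha using htay
    have hrc : ContinuousAt r (1, 1, 0) := hr.continuousAt hU
    set Cr := |r (1, 1, 0)| + 1 with hCr
    have hrb : ∀ᶠ η : ℝ in 𝓝[>] 0, ∀ s, |s - 1| ≤ η → ∀ t, |t - 1| ≤ η → ∀ u, |u| ≤ η →
        |r (s, t, u)| ≤ Cr := by
      obtain ⟨ε, hε, h⟩ := Metric.eventually_nhds_iff.1
        (hrc.abs.eventually (gt_mem_nhds (lt_add_one _)))
      filter_upwards [Ioo_mem_nhdsGT hε] with η hη s hs t ht u hu
      refine (h ?_).le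
      rw [Prod.dist_eq, max_lt_iff, Prod.dist_eq, max_lt_iff, Real.dist_eq, Real.dist_eq,
        Real.dist_eq, sub_zero]
      exact ⟨hs.trans_lt hη.2, ht.trans_lt hη.2, hu.trans_lt hη.2⟩
    have hCsum : ∀ j ∈ Finset.range (q + 1), C j ≤ ∑ j ∈ Finset.range (q + 1), C j :=
      fun j hj => Finset.single_le_sum (f := C) (fun j _ => hC j) hj
    have hCs0 : 0 ≤ ∑ j ∈ Finset.range (q + 1), C j := Finset.sum_nonneg fun j _ => hC j
    -- The pairs `(j, l)` with `j + l ≤ q`: the coefficient of `u^j` needs expansion only to order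
    -- `q + 1 - j`, as `u^j` supplies the other `j` powers of `η`.
    refine ⟨(Finset.range (q + 1)).sigma fun j => Finset.range (q + 1 - j),
      fun e s => a e.1 e.2 s, (∑ j ∈ Finset.range (q + 1), C j) + Cr, by positivity, ?_, ?_⟩
    · intro e he
      simp only [Finset.mem_sigma, Finset.mem_range] at he
      simp only [barrierDegree]
      omega
    · have hall := (Filter.eventually_all_finset (Finset.range (q + 1))).2
        (fun j hj => ha j (by simpa [Nat.lt_succ_iff] using hj))
      filter_upwards [hall, hrb, Ioo_mem_nhdsGT hδ, Ioo_mem_nhdsGT hδ'] with ζ h1 h2 h3 h4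
      refine ⟨?_, ?_⟩
      · intro e he s hs
        simp only [Finset.mem_sigma] at he
        have := (h1 e.1 he.1 s hs).1 e.2 (Finset.mem_range.1 he.2)
        have := hCsum e.1 he.1
        have : 0 ≤ Cr := by positivity
        linarith
      · intro η hη0 hη s t u hs ht hu
        have hs' : |s - 1| ≤ ζ := hs
        have ht' : |t - 1| ≤ η := ht
        have hgs := hexp s (by constructor <;> linarith [abs_le.1 hs', h3.2])
          t (by constructor <;> linarith [abs_le.1 ht', h3.2])
          u (by constructor <;> linarith [abs_le.1 hu, h4.2])
        have hdec : g s t u - ∑ e ∈ (Finset.range (q + 1)).sigma fun j => Finset.range (q + 1 - j),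
            a e.1 e.2 s * (u ^ e.1 * (t - 1) ^ e.2) =
            ∑ j ∈ Finset.range (q + 1), (gj j (s, t) -
              ∑ l ∈ Finset.range (q + 1 - j), a j l s * (t - 1) ^ l) * u ^ j +
              u ^ (q + 1) * r (s, t, u) := by
          rw [hgs, Finset.sum_sigma, add_sub_right_comm, ← Finset.sum_sub_distrib]
          congr 1
          refine Finset.sum_congr rfl fun j _ => ?_
          rw [sub_mul, Finset.sum_mul]
          congr 1
          exact Finset.sum_congr rfl fun l _ => by ring
        rw [hdec]
        refine (abs_add_le _ _).trans ?_
        rw [add_mul]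
        refine add_le_add ?_ ?_
        · refine (Finset.abs_sum_le_sum_abs _ _).trans ?_
          rw [Finset.sum_mul]
          refine Finset.sum_le_sum fun j hj => ?_
          have hb := (h1 j hj s hs').2 t (ht'.trans hη)
          rw [abs_mul, abs_pow]
          have hjq : q + 1 = (q + 1 - j) + j := by
            have := Finset.mem_range.1 hj; omega
          calc _ ≤ C j * |t - 1| ^ (q + 1 - j) * |u| ^ j := by gcongr
            _ ≤ C j * η ^ (q + 1 - j) * η ^ j := by
              have := hC j
              gcongr
            _ = C j * η ^ (q + 1) := by rw [mul_assoc, ← pow_add, ← hjq]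
        · rw [abs_mul, abs_pow, mul_comm]
          have := h2 s hs' t (ht'.trans hη) u (hu.trans hη)
          gcongr
  · obtain ⟨δ', hδ', a, r, hexp, U, hU, hr⟩ := hg
    rw [← hq] at hexp
    have hrc : ContinuousAt r 0 := hr.continuousAt hU
    set Cr := |r 0| + 1 with hCr
    have hrb : ∀ᶠ η : ℝ in 𝓝[>] 0, ∀ u, |u| ≤ η → |r u| ≤ Cr := by
      obtain ⟨ε, hε, h⟩ := Metric.eventually_nhds_iff.1
        (hrc.abs.eventually (gt_mem_nhds (lt_add_one _)))
      filter_upwards [Ioo_mem_nhdsGT hε] with η hη u hu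
      refine (h ?_).le
      rw [Real.dist_eq, sub_zero]
      exact hu.trans_lt hη.2
    have hCs0 : 0 ≤ ∑ j ∈ Finset.range (q + 1), |a j| := Finset.sum_nonneg fun j _ => abs_nonneg _
    refine ⟨(Finset.range (q + 1)).sigma fun _ => Finset.range 1,
      fun e _ => a e.1, (∑ j ∈ Finset.range (q + 1), |a j|) + Cr, by positivity, ?_, ?_⟩
    · intro e he
      simp only [Finset.mem_sigma, Finset.mem_range] at he
      simp only [barrierDegree]
      omega
    · filter_upwards [hrb, Ioo_mem_nhdsGT hδ'] with ζ h2 h4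
      refine ⟨?_, ?_⟩
      · intro e he s hs
        simp only [Finset.mem_sigma] at he
        have := Finset.single_le_sum (f := fun j => |a j|) (fun j _ => abs_nonneg _) he.1
        have : 0 ≤ Cr := by positivity
        linarith
      · intro η hη0 hη s t u hs ht hu
        have hs' : s = 1 := hs
        have ht' : t = 1 := ht
        have hgs := hexp u (by constructor <;> linarith [abs_le.1 hu, h4.2])
        rw [hs', ht', hgs, Finset.sum_sigma]
        simp only [Finset.range_one, Finset.sum_singleton, pow_zero, mul_one, add_sub_cancel_left]
        rw [abs_mul, abs_pow, mul_comm]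
        have h5 := h2 u (hu.trans hη)
        have h6 : Cr ≤ (∑ j ∈ Finset.range (q + 1), |a j|) + Cr := by linarith
        calc |r u| * |u| ^ (q + 1) ≤ Cr * η ^ (q + 1) := by gcongr
          _ ≤ _ := by gcongr

/-! ### Consequences of the eigenvalue bound -/

section Spectrum

variable {n : ℕ} {M : Matrix (Fin n) (Fin n) ℝ} {c : ℝ}

lemma mul_sum_sq_le_of_spectrum (hM : M.IsHermitian) (hc : ∀ e ∈ spectrum ℝ M, c ≤ e)
    (w : Fin n → ℝ) : c * ∑ i, w i ^ 2 ≤ w ⬝ᵥ M *ᵥ w := by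
  have h1 : algebraMap ℝ (Matrix (Fin n) (Fin n) ℝ) c ≤ M :=
    (algebraMap_le_iff_le_spectrum (a := M) (ha := hM)).2 hc
  have h2 := (Matrix.le_iff.1 h1).dotProduct_mulVec_nonneg w
  rw [Matrix.sub_mulVec, dotProduct_sub, Algebra.algebraMap_eq_smul_one, Matrix.smul_mulVec,
    Matrix.one_mulVec, dotProduct_smul] at h2
  simp only [star_trivial, smul_eq_mul] at h2
  have : w ⬝ᵥ w = ∑ i, w i ^ 2 := by simp [dotProduct, sq]
  rw [this] at h2
  linarith

lemma isUnit_det_of_spectrum (hc0 : 0 < c) (hc : ∀ e ∈ spectrum ℝ M, c ≤ e) :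
    IsUnit M.det := by
  rw [← Matrix.isUnit_iff_isUnit_det]
  by_contra h
  have h0 : (0 : ℝ) ∈ spectrum ℝ M := spectrum.zero_mem ℝ h
  linarith [hc 0 h0]

/-- The Euclidean norm of the solution is at most `√n B / c`, and Cauchy–Schwarz costs another `√n`.
The resulting factor `n` is what the kernel approximation has to beat. -/
lemma sum_abs_inv_mulVec_le (hM : M.IsHermitian) (hc0 : 0 < c)
    (hc : ∀ e ∈ spectrum ℝ M, c ≤ e) {B : ℝ} (hB : 0 ≤ B) {F : Fin n → ℝ}
    (hF : ∀ i, |F i| ≤ B) : ∑ i, |(M⁻¹ *ᵥ F) i| ≤ n * B / c := by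
  set w := M⁻¹ *ᵥ F with hw
  have hMw : M *ᵥ w = F := by
    rw [hw, Matrix.mulVec_mulVec, Matrix.mul_nonsing_inv _ (isUnit_det_of_spectrum hc0 hc),
      Matrix.one_mulVec]
  have h1 := mul_sum_sq_le_of_spectrum hM hc w
  rw [hMw] at h1
  -- Young's inequality with weight `c`, so that half of the lower bound in `h1` absorbs the
  -- quadratic term.
  have h2 : w ⬝ᵥ F ≤ ∑ i, (c / 2 * w i ^ 2 + B ^ 2 / (2 * c)) := by
    refine Finset.sum_le_sum fun i _ => ?_
    have h3 : F i ^ 2 ≤ B ^ 2 := sq_le_sq' (by linarith [abs_le.1 (hF i)]) (abs_le.1 (hF i)).2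
    have h4 : c / 2 * w i ^ 2 + F i ^ 2 / (2 * c) - w i * F i =
        (c * w i - F i) ^ 2 / (2 * c) := by field_simp; ring
    have h5 : 0 ≤ (c * w i - F i) ^ 2 / (2 * c) := by positivity
    have h6 : F i ^ 2 / (2 * c) ≤ B ^ 2 / (2 * c) := by gcongr
    linarith
  rw [Finset.sum_add_distrib, ← Finset.mul_sum] at h2
  simp only [Finset.sum_const, Finset.card_univ, Fintype.card_fin, nsmul_eq_mul] at h2
  have h3 : ∑ i, w i ^ 2 ≤ n * B ^ 2 / c ^ 2 := by
    rw [le_div_iff₀ (by positivity)]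
    have h4 : c / 2 * ∑ i, w i ^ 2 ≤ n * (B ^ 2 / (2 * c)) := by linarith
    have h5 := mul_le_mul_of_nonneg_left h4 (show 0 ≤ 2 * c by positivity)
    have h6 : 2 * c * (n * (B ^ 2 / (2 * c))) = n * B ^ 2 := by field_simp
    nlinarith
  have h4 : (∑ i, |w i|) ^ 2 ≤ n * ∑ i, w i ^ 2 := by
    have := sq_sum_le_card_mul_sum_sq (s := (Finset.univ : Finset (Fin n))) (f := fun i => |w i|)
    simpa using this
  refine abs_le_of_sq_le_sq' ?_ (by positivity) |>.2
  calc (∑ i, |w i|) ^ 2 ≤ n * (n * B ^ 2 / c ^ 2) := h4.trans (by gcongr)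
    _ = _ := by ring

end Spectrum

/-! ### The representer theorem and the averaged estimator -/

section Estimator

variable {d : ℕ} {𝒳 : Set (E d)} {H : Type*} [NormedAddCommGroup H] [InnerProductSpace ℝ H]
  [CompleteSpace H] [RKHS ℝ H 𝒳 ℝ] {g : ℝ → ℝ → ℝ → ℝ} {τ : ℝ}

lemma inner_kerFun_one (x : 𝒳) (f : H) : inner ℝ (RKHS.kerFun H x 1) f = f x := by
  rw [RKHS.kerFun_inner]; simp

lemma scaledKernel_comm
    (hH : ∀ x x' : 𝒳, RKHS.kernel H x x' 1 = scaledKernel g τ x.1 x'.1) (x x' : 𝒳) :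
    scaledKernel g τ x.1 x'.1 = scaledKernel g τ x'.1 x.1 := by
  rw [← hH, ← hH, ← RKHS.kerFun_apply, ← RKHS.kerFun_apply, ← inner_kerFun_one,
    ← inner_kerFun_one, real_inner_comm]

lemma isHermitian_kernelMatrix
    (hH : ∀ x x' : 𝒳, RKHS.kernel H x x' 1 = scaledKernel g τ x.1 x'.1) {n : ℕ}
    (x : Fin n → 𝒳) (lam : ℝ) :
    (kernelMatrix g τ x + lam • (1 : Matrix (Fin n) (Fin n) ℝ)).IsHermitian := by
  refine Matrix.IsHermitian.add ?_ ?_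
  · ext i j
    simp only [Matrix.conjTranspose_apply, kernelMatrix, Matrix.of_apply, star_trivial]
    exact scaledKernel_comm hH _ _
  · rw [Matrix.IsHermitian, Matrix.conjTranspose_smul]; simp

lemma coe_sum_kerFun {n : ℕ} (x : Fin n → 𝒳) (w : Fin n → ℝ)
    (hH : ∀ x x' : 𝒳, RKHS.kernel H x x' 1 = scaledKernel g τ x.1 x'.1) (z : 𝒳) :
    (∑ i, w i • RKHS.kerFun H (x i) 1 : H) z = ∑ i, w i * scaledKernel g τ (x i).1 z.1 := by
  rw [← inner_kerFun_one, inner_sum]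
  refine Finset.sum_congr rfl fun i _ => ?_
  rw [inner_smul_right, inner_kerFun_one, RKHS.kerFun_apply, hH, scaledKernel_comm hH]

/-- The representer theorem: both the ridge regression estimate and the minimum norm interpolant
are given by the inverse of the regularised kernel matrix. -/
lemma estimator_eq
    (hH : ∀ x x' : 𝒳, RKHS.kernel H x x' 1 = scaledKernel g τ x.1 x'.1) {n : ℕ}
    (x : Fin n → 𝒳) (y : Fin n → ℝ) {lam : ℝ} (hlam : 0 ≤ lam)
    (hM : IsUnit (kernelMatrix g τ x + lam • (1 : Matrix (Fin n) (Fin n) ℝ)).det) :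
    estimator H lam x y = ∑ i,
      ((kernelMatrix g τ x + lam • (1 : Matrix (Fin n) (Fin n) ℝ))⁻¹ *ᵥ y) i •
        RKHS.kerFun H (x i) 1 := by
  set M := kernelMatrix g τ x + lam • (1 : Matrix (Fin n) (Fin n) ℝ) with hMdef
  set w := M⁻¹ *ᵥ y with hw
  set f₀ : H := ∑ i, w i • RKHS.kerFun H (x i) 1 with hf₀
  have hMw : M *ᵥ w = y := by
    rw [hw, Matrix.mulVec_mulVec, Matrix.mul_nonsing_inv _ hM, Matrix.one_mulVec]
  have hval : ∀ i, f₀ (x i) = y i - lam * w i := by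
    intro i
    have h1 := congrFun hMw i
    rw [hMdef, Matrix.add_mulVec, Matrix.smul_mulVec, Matrix.one_mulVec] at h1
    simp only [Pi.add_apply, Pi.smul_apply, smul_eq_mul] at h1
    rw [← h1, add_sub_cancel_right, hf₀, coe_sum_kerFun x w hH]
    simp only [mulVec, dotProduct, kernelMatrix, Matrix.of_apply]
    exact Finset.sum_congr rfl fun j _ => by rw [scaledKernel_comm hH, mul_comm]
  have hinner : ∀ e : H, inner ℝ f₀ e = ∑ i, w i * e (x i) := by
    intro e
    rw [hf₀, sum_inner]
    refine Finset.sum_congr rfl fun i _ => ?_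
    rw [inner_smul_left, inner_kerFun_one]; rfl
  have hnorm : ∀ h : H, ‖h‖ ^ 2 = ‖f₀‖ ^ 2 + 2 * inner ℝ f₀ (h - f₀) + ‖h - f₀‖ ^ 2 := by
    intro h
    have := norm_add_sq_real f₀ (h - f₀)
    rwa [add_sub_cancel] at this
  -- The objective is quadratic around `f₀`. Its cross terms cancel, because the residual of `f₀` at
  -- `x i` is `lam * w i` and pairing with `f₀` is evaluation weighted by `w`.
  have hobj : ∀ h : H, ∑ i, (y i - h (x i)) ^ 2 + lam * ‖h‖ ^ 2 =
      (∑ i, (y i - f₀ (x i)) ^ 2 + lam * ‖f₀‖ ^ 2) +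
        (∑ i, ((h - f₀) (x i)) ^ 2 + lam * ‖h - f₀‖ ^ 2) := by
    intro h
    have e1 : ∀ i, (y i - h (x i)) ^ 2 = (y i - f₀ (x i)) ^ 2 + ((h - f₀) (x i)) ^ 2 -
        2 * lam * (w i * (h - f₀) (x i)) := by
      intro i
      have e2 : (h - f₀) (x i) = h (x i) - f₀ (x i) := by rw [RKHS.coe_sub]; rfl
      rw [e2, hval i]; ring
    rw [Finset.sum_congr rfl fun i _ => e1 i, Finset.sum_sub_distrib, Finset.sum_add_distrib,
      ← Finset.mul_sum, hnorm h, hinner]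
    ring
  have hex : IsEstimate H lam x y f₀ := by
    rcases hlam.eq_or_lt' with h0 | hpos
    · have hv : ∀ i, f₀ (x i) = y i := fun i => by rw [hval, h0]; ring
      refine Or.inr ⟨h0, hv, fun h hh => ?_⟩
      have h1 : inner ℝ f₀ (h - f₀) = 0 := by
        rw [hinner]
        refine Finset.sum_eq_zero fun i _ => ?_
        rw [RKHS.coe_sub, Pi.sub_apply, hh, hv]; simp
      have h2 := hnorm h
      rw [h1] at h2
      refine (sq_le_sq₀ (norm_nonneg _) (norm_nonneg _)).1 ?_
      nlinarith [sq_nonneg ‖h - f₀‖]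
    · refine Or.inl ⟨hpos, fun h => ?_⟩
      rw [hobj h]
      have : 0 ≤ ∑ i, ((h - f₀) (x i)) ^ 2 + lam * ‖h - f₀‖ ^ 2 := by positivity
      linarith
  have huniq : ∀ f : H, IsEstimate H lam x y f → f = f₀ := by
    intro f hf
    have hz : ‖f - f₀‖ ^ 2 ≤ 0 := by
      rcases hf with ⟨hpos, hmin⟩ | ⟨h0, hv, hmin⟩
      · have h1 := hmin f₀
        rw [hobj f] at h1
        have h2 : 0 ≤ ∑ i, ((f - f₀) (x i)) ^ 2 := by positivity
        have h3 : lam * ‖f - f₀‖ ^ 2 ≤ 0 := by linarith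
        by_contra! hc
        nlinarith
      · have hv0 : ∀ i, f₀ (x i) = y i := fun i => by rw [hval, h0]; ring
        have h1 : inner ℝ f₀ (f - f₀) = 0 := by
          rw [hinner]
          refine Finset.sum_eq_zero fun i _ => ?_
          rw [RKHS.coe_sub, Pi.sub_apply, hv, hv0]; simp
        have h2 := hnorm f
        rw [h1] at h2
        have h3 := pow_le_pow_left₀ (norm_nonneg _) (hmin f₀ hv0) 2
        linarith
    have : ‖f - f₀‖ = 0 := by
      have := norm_nonneg (f - f₀)
      nlinarith
    exact sub_eq_zero.1 (norm_eq_zero.1 this)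
  have hE : ∃ f : H, IsEstimate H lam x y f := ⟨f₀, hex⟩
  rw [estimator, dif_pos hE]
  exact huniq _ hE.choose_spec

/-- The coefficients of the averaged estimator in terms of the kernel functions at the inputs. -/
def avgCoeff (g : ℝ → ℝ → ℝ → ℝ) (τ : ℝ) (ρ : Measure (𝒳 × ℝ)) [IsFiniteMeasure ρ] {n : ℕ}
    (lam : ℝ) (x : Fin n → 𝒳) : Fin n → ℝ :=
  (kernelMatrix g τ x + lam • (1 : Matrix (Fin n) (Fin n) ℝ))⁻¹ *ᵥ fun i => groundTruth ρ (x i)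

/-- The estimator is linear in the responses, so averaging replaces `y i` by its conditional mean,
the ground truth at `x i`. -/
lemma avgEstimator_eq
    (hH : ∀ x x' : 𝒳, RKHS.kernel H x x' 1 = scaledKernel g τ x.1 x'.1)
    (ρ : Measure (𝒳 × ℝ)) [IsFiniteMeasure ρ] {n : ℕ}
    (x : Fin n → 𝒳) {lam : ℝ} (hlam : 0 ≤ lam)
    (hM : IsUnit (kernelMatrix g τ x + lam • (1 : Matrix (Fin n) (Fin n) ℝ)).det)
    (hint : ∀ i, Integrable (fun y => y) (ρ.condKernel (x i))) (z : 𝒳) :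
    avgEstimator H ρ lam x z = ∑ i, avgCoeff g τ ρ lam x i * scaledKernel g τ (x i).1 z.1 := by
  set M := kernelMatrix g τ x + lam • (1 : Matrix (Fin n) (Fin n) ℝ) with hMdef
  have h1 : ∀ y : Fin n → ℝ, estimator H lam x y z =
      ∑ j, y j * ∑ i, M⁻¹ i j * scaledKernel g τ (x i).1 z.1 := by
    intro y
    rw [estimator_eq hH x y hlam hM, coe_sum_kerFun x _ hH]
    simp only [mulVec, dotProduct, Finset.sum_mul, Finset.mul_sum]
    rw [Finset.sum_comm]
    exact Finset.sum_congr rfl fun j _ => Finset.sum_congr rfl fun i _ => by ring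
  unfold avgEstimator
  simp_rw [h1]
  rw [integral_finsetSum]
  · have h2 : ∀ j, ∫ y : Fin n → ℝ, y j ∂(Measure.pi fun i => ρ.condKernel (x i)) =
        groundTruth ρ (x j) := fun j =>
      integral_comp_eval (μ := fun i => ρ.condKernel (x i)) (f := fun y : ℝ => y)
        (by fun_prop)
    simp_rw [integral_mul_const, h2]
    simp only [avgCoeff, ← hMdef, mulVec, dotProduct, Finset.sum_mul, Finset.mul_sum]
    rw [Finset.sum_comm]
    exact Finset.sum_congr rfl fun j _ => Finset.sum_congr rfl fun i _ => by ring
  · intro j _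
    exact (integrable_comp_eval (μ := fun i => ρ.condKernel (x i)) (hint j)).mul_const _

end Estimator

/-! ### The approximating polynomials and their growth -/

section Polynomial

variable {d : ℕ}

/-- The polynomial `z ↦ ∑ e ∈ I, a e (‖x‖² / τ) (⟨x, z⟩ / τ) ^ e.1 (‖z‖² / τ - 1) ^ e.2`. -/
def kernelPoly (I : Finset ((_ : ℕ) × ℕ)) (a : ((_ : ℕ) × ℕ) → ℝ → ℝ) (τ : ℝ) (x : E d) :
    MvPolynomial (Fin d) ℝ :=
  ∑ e ∈ I, MvPolynomial.C (a e (‖x‖ ^ 2 / τ)) *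
    ((MvPolynomial.C τ⁻¹ * ∑ j, MvPolynomial.C (x j) * MvPolynomial.X j) ^ e.1 *
      (MvPolynomial.C τ⁻¹ * ∑ j, MvPolynomial.X j ^ 2 - MvPolynomial.C 1) ^ e.2)

lemma polyEval_kernelPoly (I : Finset ((_ : ℕ) × ℕ)) (a : ((_ : ℕ) × ℕ) → ℝ → ℝ) (τ : ℝ)
    (x z : E d) : polyEval (kernelPoly I a τ x) z =
      ∑ e ∈ I, a e (‖x‖ ^ 2 / τ) * ((inner ℝ x z / τ) ^ e.1 * (‖z‖ ^ 2 / τ - 1) ^ e.2) := by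
  have h1 : inner ℝ x z = ∑ j, x j * z j := by
    rw [EuclideanSpace.inner_eq_star_dotProduct]
    simp [dotProduct, mul_comm]
  simp only [polyEval, kernelPoly, map_sum, map_mul, map_pow, map_sub, MvPolynomial.eval_C,
    MvPolynomial.eval_X]
  rw [h1, EuclideanSpace.real_norm_sq_eq z]
  refine Finset.sum_congr rfl fun e _ => ?_
  simp only [div_eq_inv_mul]

lemma totalDegree_kernelPoly_le {I : Finset ((_ : ℕ) × ℕ)} (a : ((_ : ℕ) × ℕ) → ℝ → ℝ)
    (τ : ℝ) (x : E d) {m : ℕ} (hI : ∀ e ∈ I, e.1 + 2 * e.2 ≤ m) :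
    (kernelPoly I a τ x).totalDegree ≤ m := by
  have hC : ∀ (c : ℝ) (p : MvPolynomial (Fin d) ℝ) (k : ℕ), p.totalDegree ≤ k →
      (MvPolynomial.C c * p).totalDegree ≤ k := fun c p k hp => by
    refine (MvPolynomial.totalDegree_mul _ _).trans ?_
    simpa using hp
  have hX : ∀ (j : Fin d) (k : ℕ), (MvPolynomial.X j ^ k : MvPolynomial (Fin d) ℝ).totalDegree ≤ k :=
    fun j k => (MvPolynomial.totalDegree_X_pow j k).le
  refine MvPolynomial.totalDegree_finsetSum_le fun e he => hC _ _ _ ?_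
  refine (MvPolynomial.totalDegree_mul _ _).trans (le_trans (add_le_add ?_ ?_) (hI e he))
  · refine (MvPolynomial.totalDegree_pow _ _).trans ?_
    have : (MvPolynomial.C τ⁻¹ * ∑ j, MvPolynomial.C (x j) * MvPolynomial.X j :
        MvPolynomial (Fin d) ℝ).totalDegree ≤ 1 :=
      hC _ _ _ (MvPolynomial.totalDegree_finsetSum_le fun j _ => hC _ _ _ (by
        simp))
    nlinarith
  · refine (MvPolynomial.totalDegree_pow _ _).trans ?_
    have : (MvPolynomial.C τ⁻¹ * ∑ j, MvPolynomial.X j ^ 2 - MvPolynomial.C 1 :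
        MvPolynomial (Fin d) ℝ).totalDegree ≤ 2 := by
      refine (MvPolynomial.totalDegree_sub _ _).trans (max_le ?_ (by simp))
      exact hC _ _ _ (MvPolynomial.totalDegree_finsetSum_le fun j _ => hX j 2)
    nlinarith

/-- The polynomial approximation of the averaged estimator. -/
def approxPoly {n : ℕ} (I : Finset ((_ : ℕ) × ℕ)) (a : ((_ : ℕ) × ℕ) → ℝ → ℝ) (τ : ℝ)
    (α : Fin n → ℝ) (x : Fin n → E d) : MvPolynomial (Fin d) ℝ :=
  ∑ i, MvPolynomial.C (α i) * kernelPoly I a τ (x i)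

lemma polyEval_approxPoly {n : ℕ} (I : Finset ((_ : ℕ) × ℕ)) (a : ((_ : ℕ) × ℕ) → ℝ → ℝ)
    (τ : ℝ) (α : Fin n → ℝ) (x : Fin n → E d) (z : E d) :
    polyEval (approxPoly I a τ α x) z = ∑ i, α i * polyEval (kernelPoly I a τ (x i)) z := by
  simp [polyEval, approxPoly]

lemma approxPoly_mem_polySpace {n : ℕ} {I : Finset ((_ : ℕ) × ℕ)} (a : ((_ : ℕ) × ℕ) → ℝ → ℝ)
    (τ : ℝ) (α : Fin n → ℝ) (x : Fin n → E d) {m : ℕ} (hI : ∀ e ∈ I, e.1 + 2 * e.2 ≤ m) :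
    approxPoly I a τ α x ∈ polySpace d m := by
  refine MvPolynomial.totalDegree_finsetSum_le fun i _ => ?_
  refine (MvPolynomial.totalDegree_mul _ _).trans ?_
  simpa using totalDegree_kernelPoly_le a τ (x i) hI

lemma abs_inner_div_le {τ : ℝ} (hτ : 0 < τ) {x z : E d} (hx : ‖x‖ ^ 2 / τ ≤ 2) :
    |inner ℝ x z / τ| ≤ 1 + ‖z‖ ^ 2 / τ := by
  have h1 := abs_real_inner_le_norm x z
  rw [abs_div, abs_of_pos hτ, div_le_iff₀ hτ]
  rw [div_le_iff₀ hτ] at hx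
  have : (1 + ‖z‖ ^ 2 / τ) * τ = τ + ‖z‖ ^ 2 := by field_simp
  rw [this]
  nlinarith [sq_nonneg (‖x‖ - ‖z‖), sq_nonneg ‖z‖]

/-- Holds at every point, typical or not: with `T = 1 + ‖z‖² / τ`, both `|⟨x, z⟩| / τ` and `|‖z‖² /
τ - 1|` are at most `T`, so each monomial is at most `T ^ m`. -/
lemma abs_polyEval_approxPoly_le {n : ℕ} {I : Finset ((_ : ℕ) × ℕ)}
    {a : ((_ : ℕ) × ℕ) → ℝ → ℝ} {τ C L δ : ℝ} (hτ : 0 < τ) (hC : 0 ≤ C) (hδ : δ ≤ 1) {m : ℕ}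
    (hI : ∀ e ∈ I, e.1 + 2 * e.2 ≤ m) (ha : ∀ e ∈ I, ∀ s, |s - 1| ≤ δ → |a e s| ≤ C)
    {α : Fin n → ℝ} (hα : ∑ i, |α i| ≤ L) {x : Fin n → E d}
    (hx : ∀ i, |‖x i‖ ^ 2 / τ - 1| ≤ δ) (z : E d) :
    |polyEval (approxPoly I a τ α x) z| ≤ L * (I.card * C) * (1 + ‖z‖ ^ 2 / τ) ^ m := by
  set T := 1 + ‖z‖ ^ 2 / τ with hT
  have ht0 : 0 ≤ ‖z‖ ^ 2 / τ := by positivity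
  have hT1 : 1 ≤ T := by linarith
  have hk : ∀ i, |polyEval (kernelPoly I a τ (x i)) z| ≤ I.card * C * T ^ m := by
    intro i
    rw [polyEval_kernelPoly, mul_assoc, ← nsmul_eq_mul]
    refine (Finset.abs_sum_le_sum_abs _ _).trans (Finset.sum_le_card_nsmul _ _ _ fun e he => ?_)
    have h1 := ha e he _ (hx i)
    have h2 := abs_inner_div_le hτ (z := z) (x := x i) (by linarith [(abs_le.1 (hx i)).2])
    have h3 : |‖z‖ ^ 2 / τ - 1| ≤ T := by rw [abs_le]; constructor <;> linarith
    rw [abs_mul, abs_mul, abs_pow, abs_pow]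
    calc _ ≤ C * (T ^ e.1 * T ^ e.2) := by gcongr
      _ = C * T ^ (e.1 + e.2) := by rw [pow_add]
      _ ≤ C * T ^ m := by
        have := hI e he
        gcongr
        omega
  rw [polyEval_approxPoly]
  calc |∑ i, α i * polyEval (kernelPoly I a τ (x i)) z|
      ≤ ∑ i, |α i| * (I.card * C * T ^ m) := by
        refine (Finset.abs_sum_le_sum_abs _ _).trans (Finset.sum_le_sum fun i _ => ?_)
        rw [abs_mul]
        gcongr
        exact hk i
    _ = (∑ i, |α i|) * (I.card * C * T ^ m) := by rw [Finset.sum_mul]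
    _ ≤ L * (I.card * C * T ^ m) := by gcongr
    _ = _ := by ring

lemma abs_sum_scaledKernel_sub_approxPoly_le {n : ℕ} {I : Finset ((_ : ℕ) × ℕ)}
    {a : ((_ : ℕ) × ℕ) → ℝ → ℝ} {g : ℝ → ℝ → ℝ → ℝ} {τ D L : ℝ} (hD : 0 ≤ D)
    {α : Fin n → ℝ} (hα : ∑ i, |α i| ≤ L) {x : Fin n → E d} {z : E d}
    (hg : ∀ i, |g (‖x i‖ ^ 2 / τ) (‖z‖ ^ 2 / τ) (inner ℝ (x i) z / τ) - ∑ e ∈ I,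
      a e (‖x i‖ ^ 2 / τ) * ((inner ℝ (x i) z / τ) ^ e.1 * (‖z‖ ^ 2 / τ - 1) ^ e.2)| ≤ D) :
    |∑ i, α i * scaledKernel g τ (x i) z - polyEval (approxPoly I a τ α x) z| ≤ L * D := by
  rw [polyEval_approxPoly, ← Finset.sum_sub_distrib]
  calc |∑ i, (α i * scaledKernel g τ (x i) z - α i * polyEval (kernelPoly I a τ (x i)) z)|
      ≤ ∑ i, |α i| * D := by
        refine (Finset.abs_sum_le_sum_abs _ _).trans (Finset.sum_le_sum fun i _ => ?_)
        rw [← mul_sub, abs_mul, polyEval_kernelPoly]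
        gcongr
        exact hg i
    _ = (∑ i, |α i|) * D := by rw [Finset.sum_mul]
    _ ≤ L * D := by gcongr

end Polynomial

/-! ### The `L²` tail on a rare event -/

/-- The `L²` norm of a polynomially growing function on an event of small probability. -/
lemma eLpNorm_indicator_compl_le {α : Type*} [MeasurableSpace α] {P : Measure α} {t : α → ℝ}
    (ht : Measurable t) (ht0 : ∀ z, 0 ≤ t z) {G : Set α} (hG : MeasurableSet G) {b Mo Q r : ℝ}
    (hr : 0 < r) (hb0 : 0 ≤ b) (hMo0 : 0 ≤ Mo) (hQ : 0 ≤ Q) {m : ℕ} (hb : P Gᶜ ≤ ENNReal.ofReal b)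
    (hMo : ∫⁻ z, ENNReal.ofReal ((1 + t z) ^ (4 * m)) ∂P ≤ ENNReal.ofReal Mo) :
    eLpNorm (fun z => Gᶜ.indicator (fun z => Q * (1 + t z) ^ m) z) 2 P ≤
      ENNReal.ofReal (Q * √(r * b + Mo / r)) := by
  -- The pointwise bound `y ≤ r + y² / r` with `y = (1 + t)^(2m)` stands in for Cauchy–Schwarz; the
  -- free parameter `r` is later taken between `1` and the inverse of the probability.
  have hpt : ∀ z, ‖Gᶜ.indicator (fun z => Q * (1 + t z) ^ m) z‖ₑ ^ (2 : ℝ) ≤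
      ENNReal.ofReal (Q ^ 2 * r) * Gᶜ.indicator 1 z +
        ENNReal.ofReal (Q ^ 2 / r) * ENNReal.ofReal ((1 + t z) ^ (4 * m)) := by
    intro z
    have h0 := ht0 z
    by_cases hz : z ∈ Gᶜ
    · simp only [Set.indicator_of_mem hz, Pi.one_apply, mul_one]
      rw [Real.enorm_of_nonneg (by positivity), ENNReal.rpow_two,
        ← ENNReal.ofReal_pow (by positivity),
        ← ENNReal.ofReal_mul (by positivity), ← ENNReal.ofReal_add (by positivity) (by positivity)]
      apply ENNReal.ofReal_le_ofReal
      set y := (1 + t z) ^ (2 * m) with hy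
      have e1 : (1 + t z) ^ (4 * m) = y ^ 2 := by rw [hy, ← pow_mul]; congr 1; ring
      have e2 : (Q * (1 + t z) ^ m) ^ 2 = Q ^ 2 * y := by
        rw [mul_pow, hy, ← pow_mul]; congr 2; ring
      rw [e1, e2]
      have e3 : Q ^ 2 * r + Q ^ 2 / r * y ^ 2 - Q ^ 2 * y =
          Q ^ 2 / r * ((r - y / 2) ^ 2 + 3 / 4 * y ^ 2) := by field_simp; ring
      have : 0 ≤ Q ^ 2 / r * ((r - y / 2) ^ 2 + 3 / 4 * y ^ 2) := by positivity
      linarith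
    · simp [Set.indicator_of_notMem hz]
  have hint : ∫⁻ z, ‖Gᶜ.indicator (fun z => Q * (1 + t z) ^ m) z‖ₑ ^ (2 : ℝ) ∂P ≤
      ENNReal.ofReal ((Q * √(r * b + Mo / r)) ^ 2) := by
    refine (lintegral_mono hpt).trans ?_
    rw [lintegral_add_right _ (by fun_prop), lintegral_const_mul _ (measurable_one.indicator hG.compl),
      lintegral_indicator_one hG.compl, lintegral_const_mul _ (by fun_prop)]
    calc _ ≤ ENNReal.ofReal (Q ^ 2 * r) * ENNReal.ofReal b +
          ENNReal.ofReal (Q ^ 2 / r) * ENNReal.ofReal Mo := by gcongr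
      _ = _ := by
        rw [← ENNReal.ofReal_mul (by positivity), ← ENNReal.ofReal_mul (by positivity),
          ← ENNReal.ofReal_add (by positivity) (by positivity), mul_pow,
          Real.sq_sqrt (by positivity)]
        congr 1
        field_simp
  rw [eLpNorm_eq_lintegral_rpow_enorm_toReal (by simp) (by simp)]
  simp only [ENNReal.toReal_ofNat]
  calc _ ≤ (ENNReal.ofReal ((Q * √(r * b + Mo / r)) ^ 2)) ^ (1 / 2 : ℝ) := by gcongr
    _ = _ := by
      rw [ENNReal.ofReal_pow (by positivity), ← ENNReal.rpow_two, ← ENNReal.rpow_mul]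
      norm_num

/-! ### Stretched exponentials against powers and logarithms -/

section Asymptotics

/-- Stretched exponentials beat powers. -/
lemma tendsto_pow_mul_exp_neg_rpow {c γ : ℝ} (hc : 0 < c) (hγ : 0 < γ) (k : ℕ) :
    Tendsto (fun n : ℕ => (n : ℝ) ^ k * Real.exp (-(c * (n : ℝ) ^ γ))) atTop (𝓝 0) := by
  have h1 := tendsto_rpow_mul_exp_neg_mul_atTop_nhds_zero (k / γ) c hc
  have h2 := h1.comp ((tendsto_rpow_atTop hγ).comp (tendsto_natCast_atTop_atTop (R := ℝ)))
  refine h2.congr fun n => ?_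
  simp only [Function.comp_apply]
  rw [← Real.rpow_mul (Nat.cast_nonneg n), mul_div_cancel₀ _ hγ.ne', Real.rpow_natCast, neg_mul]

lemma summable_pow_mul_exp_neg_rpow {c γ : ℝ} (hc : 0 < c) (hγ : 0 < γ) (k : ℕ) :
    Summable (fun n : ℕ => (n : ℝ) ^ k * Real.exp (-(c * (n : ℝ) ^ γ))) := by
  have h := (tendsto_pow_mul_exp_neg_rpow hc hγ (k + 2)).eventually (gt_mem_nhds one_pos)
  have hs : Summable fun n : ℕ => (1 : ℝ) / (n : ℝ) ^ 2 := Real.summable_one_div_nat_pow.2 (by norm_num)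
  refine Summable.of_norm_bounded_eventually_nat hs ?_
  filter_upwards [h, eventually_gt_atTop 0] with n hn hn0
  have : (0 : ℝ) < n := by exact_mod_cast hn0
  rw [Real.norm_of_nonneg (by positivity), le_div_iff₀ (by positivity)]
  rw [pow_add] at hn
  linarith

/-- Split the exponential into two equal factors: one absorbs the constant `2 * |K|`, the other is
below `exp (-(log n)^r)`, because any power of the logarithm is `o(n^γ)`. -/
lemma eventually_exp_neg_rpow_le {c γ K : ℝ} (hc : 0 < c) (hγ : 0 < γ) (r : ℝ) :
    ∀ᶠ n : ℕ in atTop, (n + 1) * K * Real.exp (-(c * (n : ℝ) ^ γ)) ≤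
      (n : ℝ) ^ 2 * Real.exp (-1 * Real.log n ^ r) := by
  have h1 := (isLittleO_log_rpow_rpow_atTop r hγ).comp_tendsto
    (tendsto_natCast_atTop_atTop (R := ℝ))
  have h2 := h1.def (show 0 < c / 2 by positivity)
  have h3 := (tendsto_pow_mul_exp_neg_rpow (half_pos hc) hγ 0).mul_const (2 * |K|)
  rw [zero_mul] at h3
  filter_upwards [h2, h3.eventually (gt_mem_nhds one_pos), eventually_ge_atTop 1] with n h2 h3 hn
  have hn1 : (1 : ℝ) ≤ n := by exact_mod_cast hn
  simp only [Function.comp_apply, Real.norm_eq_abs] at h2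
  rw [abs_of_nonneg (by positivity : (0 : ℝ) ≤ (n : ℝ) ^ γ)] at h2
  have h4 : Real.log n ^ r ≤ c / 2 * (n : ℝ) ^ γ := (le_abs_self _).trans h2
  have h5 : Real.exp (-(c * (n : ℝ) ^ γ)) =
      Real.exp (-(c / 2 * (n : ℝ) ^ γ)) * Real.exp (-(c / 2 * (n : ℝ) ^ γ)) := by
    rw [← Real.exp_add]; congr 1; ring
  set X := Real.exp (-(c / 2 * (n : ℝ) ^ γ)) with hX
  have hX0 : 0 < X := Real.exp_pos _
  rw [h5]
  calc (n + 1) * K * (X * X) ≤ (2 * n) * |K| * (X * X) := by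
        have e1 := mul_le_mul_of_nonneg_left (le_abs_self K) (show (0 : ℝ) ≤ n + 1 by positivity)
        have e2 := mul_le_mul_of_nonneg_right (show (n : ℝ) + 1 ≤ 2 * n by linarith) (abs_nonneg K)
        exact mul_le_mul_of_nonneg_right (e1.trans e2) (by positivity)
    _ = n * ((n : ℝ) ^ 0 * X * (2 * |K|)) * X := by ring
    _ ≤ n * 1 * X := by gcongr
    _ ≤ (n : ℝ) ^ 2 * Real.exp (-1 * Real.log n ^ r) := by
        refine mul_le_mul (by nlinarith) (Real.exp_le_exp.2 (by linarith)) hX0.le (by positivity)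

end Asymptotics

/-! ### Typical inputs and good data at a fixed sample size -/

section FixedSize

variable {d : ℕ} {𝒳 : Set (E d)}

/-- The inputs at which the approximation of the averaged estimator is accurate. -/
def goodSet (model : InputModel) (τ η : ℝ) {n : ℕ} (x : Fin n → 𝒳) : Set 𝒳 :=
  {z | NormGood model η (‖(z : E d)‖ ^ 2 / τ) ∧
    ∀ i, |inner ℝ (x i : E d) (z : E d) / τ| ≤ η}

lemma measurable_normSq_div (τ : ℝ) : Measurable fun z : 𝒳 => ‖(z : E d)‖ ^ 2 / τ := by
  have : Measurable fun z : E d => ‖z‖ ^ 2 / τ := by fun_prop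
  exact this.comp measurable_subtype_coe

lemma measurableSet_goodSet (model : InputModel) (τ η : ℝ) {n : ℕ} (x : Fin n → 𝒳) :
    MeasurableSet (goodSet model τ η x) := by
  refine MeasurableSet.inter ((measurableSet_normGood model η).preimage
    (measurable_normSq_div τ)) ?_
  have e : {z : 𝒳 | ∀ i, |inner ℝ (x i : E d) (z : E d) / τ| ≤ η} =
      ⋂ i, {z : 𝒳 | |inner ℝ (x i : E d) (z : E d) / τ| ≤ η} := by ext; simp
  show MeasurableSet {z : 𝒳 | ∀ i, |inner ℝ (x i : E d) (z : E d) / τ| ≤ η}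
  rw [e]
  refine MeasurableSet.iInter fun i => measurableSet_le ?_ measurable_const
  have : Measurable fun z : E d => |inner ℝ (x i : E d) z / τ| := by fun_prop
  exact this.comp measurable_subtype_coe

variable {S : Matrix (Fin d) (Fin d) ℝ} {v : ℝ} {ν : Measure ℝ} {P : Measure 𝒳}
  {model : InputModel}

lemma measure_preimage_val (hP : P.map Subtype.val = inputLaw model S ν) {A : Set (E d)}
    (hA : MeasurableSet A) : P (Subtype.val ⁻¹' A) = inputLaw model S ν A := by
  rw [← hP, Measure.map_apply measurable_subtype_coe hA]

/-- Constant in front of the tail bounds of the input law. -/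
def tailConst (v : ℝ) : ℝ := 2 * Real.exp (v / 2) + quadConst v

lemma tailConst_pos (v : ℝ) : 0 < tailConst v := by
  unfold tailConst quadConst; positivity

lemma measure_not_normGood_le (hP : P.map Subtype.val = inputLaw model S ν) (hS : S.PosSemidef)
    (h1 : ‖S‖ = 1) (h : SubGaussianLaw v ν) (hv : 1 ≤ v) (hτ : 1 ≤ effDim S) {η : ℝ}
    (hη0 : 0 ≤ η) (hη : η ≤ 1) :
    P {z : 𝒳 | ¬ NormGood model η (‖(z : E d)‖ ^ 2 / effDim S)} ≤
      ENNReal.ofReal (tailConst v * Real.exp (-(η * √(effDim S) / (32 * v)))) := by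
  have hm : MeasurableSet {z : E d | ¬ NormGood model η (‖z‖ ^ 2 / effDim S)} :=
    (measurableSet_normGood model η).compl.preimage
      (show Measurable fun z : E d => ‖z‖ ^ 2 / effDim S by fun_prop)
  have h2 := measure_preimage_val hP hm
  refine (h2.le.trans (inputLaw_not_normGood model hS h1 h (by linarith) hτ hη)).trans
    (ENNReal.ofReal_le_ofReal ?_)
  have hx : 0 ≤ η * √(effDim S) := by positivity
  have h3 : η * √(effDim S) / (32 * v) ≤ η * √(effDim S) / (16 * v) :=
    div_le_div_of_nonneg_left hx (by linarith) (by linarith)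
  have : 0 ≤ quadConst v := by unfold quadConst; positivity
  refine mul_le_mul ?_ (Real.exp_le_exp.2 (neg_le_neg h3)) (Real.exp_pos _).le
    (tailConst_pos v).le
  unfold tailConst
  have := Real.exp_pos (v / 2)
  linarith

/-- Union bound over one norm event and `n` inner products. The data points are fixed here and only
their norms matter. -/
lemma measure_compl_goodSet_le (hP : P.map Subtype.val = inputLaw model S ν) (hS : S.PosSemidef)
    (h1 : ‖S‖ = 1) (h : SubGaussianLaw v ν) (hv : 1 ≤ v) (hτ : 1 ≤ effDim S) {η : ℝ}
    (hη0 : 0 ≤ η) (hη : η ≤ 1) {n : ℕ} (x : Fin n → 𝒳)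
    (hx : ∀ i, ‖(x i : E d)‖ ^ 2 / effDim S ≤ 2) :
    P (goodSet model (effDim S) η x)ᶜ ≤
      ENNReal.ofReal ((n + 1) * tailConst v * Real.exp (-(η * √(effDim S) / (32 * v)))) := by
  have hτ0 : 0 < effDim S := by linarith
  set y := tailConst v * Real.exp (-(η * √(effDim S) / (32 * v))) with hy
  have hy0 : 0 ≤ y := mul_nonneg (tailConst_pos v).le (Real.exp_pos _).le
  have hsub : (goodSet model (effDim S) η x)ᶜ ⊆
      {z : 𝒳 | ¬ NormGood model η (‖(z : E d)‖ ^ 2 / effDim S)} ∪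
        ⋃ i, {z : 𝒳 | η < |inner ℝ (x i : E d) (z : E d) / effDim S|} := by
    intro z hz
    by_cases hg : NormGood model η (‖(z : E d)‖ ^ 2 / effDim S)
    · right
      by_contra hc
      refine hz ⟨hg, fun i => ?_⟩
      by_contra hi
      exact hc (Set.mem_iUnion.2 ⟨i, not_le.1 hi⟩)
    · exact Or.inl hg
  have hin : ∀ i, P {z : 𝒳 | η < |inner ℝ (x i : E d) (z : E d) / effDim S|} ≤
      ENNReal.ofReal y := by
    intro i
    have hm : MeasurableSet {z : E d | η < |inner ℝ (x i : E d) z / effDim S|} :=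
      measurableSet_lt measurable_const (by fun_prop)
    have h2 := measure_preimage_val hP hm
    exact h2.le.trans (inputLaw_inner_tail model hS h1 h hv hτ _
      ((div_le_iff₀ hτ0).1 (hx i)) hη0 hη)
  calc P (goodSet model (effDim S) η x)ᶜ
      ≤ P {z : 𝒳 | ¬ NormGood model η (‖(z : E d)‖ ^ 2 / effDim S)} +
        ∑ i, P {z : 𝒳 | η < |inner ℝ (x i : E d) (z : E d) / effDim S|} :=
        (measure_mono hsub).trans ((measure_union_le _ _).trans
          (add_le_add le_rfl (measure_iUnion_fintype_le _ _)))
    _ ≤ ENNReal.ofReal y + ∑ _i : Fin n, ENNReal.ofReal y :=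
        add_le_add (measure_not_normGood_le hP hS h1 h hv hτ hη0 hη)
          (Finset.sum_le_sum fun i _ => hin i)
    _ = _ := by
        rw [Finset.sum_const, Finset.card_univ, Fintype.card_fin, nsmul_eq_mul,
          ← ENNReal.ofReal_natCast, ← ENNReal.ofReal_mul (Nat.cast_nonneg n),
          ← ENNReal.ofReal_add hy0 (by positivity)]
        congr 1
        rw [mul_assoc, ← hy]; ring

lemma lintegral_normSq_pow_le (hP : P.map Subtype.val = inputLaw model S ν) (hS : S.PosSemidef)
    (h1 : ‖S‖ = 1) (h : SubGaussianLaw v ν) (hv : 0 < v) (hτ : 0 < effDim S) (k : ℕ) :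
    ∫⁻ z : 𝒳, ENNReal.ofReal ((1 + ‖(z : E d)‖ ^ 2 / effDim S) ^ k) ∂P ≤
      ENNReal.ofReal (momentConst v k) := by
  refine le_trans (le_of_eq ?_) (lintegral_inputLaw_pow_le model hS h1 h hv hτ k)
  rw [← hP, lintegral_map (by fun_prop) measurable_subtype_coe]

variable {g : ℝ → ℝ → ℝ → ℝ} (ρ : Measure (𝒳 × ℝ)) [IsProbabilityMeasure ρ]

/-- The deterministic properties of the inputs of a data set that are used in the approximation. -/
structure GoodData (model : InputModel) (g : ℝ → ℝ → ℝ → ℝ) (τ δ B c lam : ℝ) {n : ℕ}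
    (x : Fin n → 𝒳) : Prop where
  normGood : ∀ i, NormGood model δ (‖(x i : E d)‖ ^ 2 / τ)
  abs_groundTruth_le : ∀ i, |groundTruth ρ (x i)| ≤ B
  integrable : ∀ i, Integrable (fun y => y) (ρ.condKernel (x i))
  mem_support : ∀ i, x i ∈ ρ.fst.support
  le_eigenvalue : ∀ e ∈ spectrum ℝ
    (kernelMatrix g τ x + lam • (1 : Matrix (Fin n) (Fin n) ℝ)), c ≤ e

variable {ρ} {H : Type*} [NormedAddCommGroup H] [InnerProductSpace ℝ H]
  [CompleteSpace H] [RKHS ℝ H 𝒳 ℝ] {τ δ B c lam : ℝ} {n : ℕ} {x : Fin n → 𝒳}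

lemma GoodData.sum_abs_avgCoeff_le (hx : GoodData ρ model g τ δ B c lam x)
    (hH : ∀ x x' : 𝒳, RKHS.kernel H x x' 1 = scaledKernel g τ x.1 x'.1) (hc : 0 < c)
    (hB : 0 ≤ B) : ∑ i, |avgCoeff g τ ρ lam x i| ≤ n * B / c :=
  sum_abs_inv_mulVec_le (isHermitian_kernelMatrix hH x lam) hc hx.le_eigenvalue hB
    hx.abs_groundTruth_le

lemma GoodData.avgEstimator_eq (hx : GoodData ρ model g τ δ B c lam x)
    (hH : ∀ x x' : 𝒳, RKHS.kernel H x x' 1 = scaledKernel g τ x.1 x'.1) (hc : 0 < c)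
    (hlam : 0 ≤ lam) (z : 𝒳) : avgEstimator H ρ lam x z =
      ∑ i, avgCoeff g τ ρ lam x i * scaledKernel g τ (x i).1 z.1 :=
  PolyBarrier.avgEstimator_eq hH ρ x hlam (isUnit_det_of_spectrum hc hx.le_eigenvalue)
    hx.integrable z

lemma GoodData.measurable_avgEstimator (hx : GoodData ρ model g τ δ B c lam x)
    (hH : ∀ x x' : 𝒳, RKHS.kernel H x x' 1 = scaledKernel g τ x.1 x'.1) (hc : 0 < c)
    (hlam : 0 ≤ lam)
    (hcont : Continuous fun p : 𝒳 × 𝒳 => scaledKernel g τ p.1.1 p.2.1) :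
    Measurable (avgEstimator H ρ lam x) := by
  have hk : Continuous fun z : 𝒳 =>
      ∑ i, avgCoeff g τ ρ lam x i * scaledKernel g τ (x i).1 z.1 := by
    refine continuous_finsetSum _ fun i _ => Continuous.mul continuous_const ?_
    exact hcont.comp (f := fun z : 𝒳 => (x i, z)) (by fun_prop)
  have e : avgEstimator H ρ lam x =
      fun z => ∑ i, avgCoeff g τ ρ lam x i * scaledKernel g τ (x i).1 z.1 :=
    funext fun z => hx.avgEstimator_eq hH hc hlam z
  rw [e]
  exact hk.measurable

/-- A crude bound, growing linearly in `n`; it is used only on an event of stretched-exponentially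
small probability. -/
lemma GoodData.abs_avgEstimator_le (hx : GoodData ρ model g τ δ B c lam x)
    (hH : ∀ x x' : 𝒳, RKHS.kernel H x x' 1 = scaledKernel g τ x.1 x'.1) (hc : 0 < c)
    (hB : 0 ≤ B) (hlam : 0 ≤ lam) {M : ℝ} (hM0 : 0 ≤ M)
    (hM : ∀ x ∈ ρ.fst.support, ∀ x' ∈ ρ.fst.support, |scaledKernel g τ x.1 x'.1| ≤ M)
    {z : 𝒳} (hz : z ∈ ρ.fst.support) : |avgEstimator H ρ lam x z| ≤ n * B / c * M := by
  rw [hx.avgEstimator_eq hH hc hlam]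
  refine (Finset.abs_sum_le_sum_abs _ _).trans ?_
  calc ∑ i, |avgCoeff g τ ρ lam x i * scaledKernel g τ (x i).1 z.1|
      ≤ ∑ i, |avgCoeff g τ ρ lam x i| * M := by
        refine Finset.sum_le_sum fun i _ => ?_
        rw [abs_mul]
        gcongr
        exact hM _ (hx.mem_support i) _ hz
    _ = (∑ i, |avgCoeff g τ ρ lam x i|) * M := by rw [Finset.sum_mul]
    _ ≤ _ := by gcongr; exact hx.sum_abs_avgCoeff_le hH hc hB

end FixedSize

/-! ### Borel–Cantelli and limits -/

/-- Borel--Cantelli for data sets whose size grows. -/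
lemma ae_eventually_forall_notMem {Ω : Type*} [MeasurableSpace Ω] {μ : Measure Ω}
    {𝒴 : ℕ → Type*} [∀ n, MeasurableSpace (𝒴 n)] {P : (n : ℕ) → Measure (𝒴 n)}
    {X : (n : ℕ) → Fin n → Ω → 𝒴 n} (hX : ∀ n i, HasLaw (X n i) (P n) μ)
    {bad : (n : ℕ) → Set (𝒴 n)} (hbad : ∀ n, MeasurableSet (bad n)) {K c γ : ℝ}
    (hc : 0 < c) (hγ : 0 < γ)
    (h : ∀ᶠ n : ℕ in atTop, P n (bad n) ≤ ENNReal.ofReal (K * Real.exp (-(c * (n : ℝ) ^ γ)))) :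
    ∀ᵐ ω ∂μ, ∀ᶠ n in atTop, ∀ i, X n i ω ∉ bad n := by
  obtain ⟨N, hN⟩ := eventually_atTop.1 h
  let s : ℕ → Set Ω := fun n => if N ≤ n then ⋃ i, X n i ⁻¹' bad n else ∅
  have hs : ∀ n, μ (s n) ≤
      ENNReal.ofReal (K * ((n : ℝ) ^ 1 * Real.exp (-(c * (n : ℝ) ^ γ)))) := by
    intro n
    by_cases hn : N ≤ n
    · simp only [s, if_pos hn]
      refine (measure_iUnion_fintype_le _ _).trans ?_
      have h1 : ∀ i, μ (X n i ⁻¹' bad n) ≤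
          ENNReal.ofReal (K * Real.exp (-(c * (n : ℝ) ^ γ))) := by
        intro i
        rw [← Measure.map_apply_of_aemeasurable (hX n i).aemeasurable (hbad n), (hX n i).map_eq]
        exact hN n hn
      refine (Finset.sum_le_sum fun i _ => h1 i).trans (le_of_eq ?_)
      rw [Finset.sum_const, Finset.card_univ, Fintype.card_fin, nsmul_eq_mul,
        ← ENNReal.ofReal_natCast, ← ENNReal.ofReal_mul (Nat.cast_nonneg n)]
      congr 1; ring
    · simp [s, if_neg hn]
  have hsum : ∑' n, μ (s n) ≠ ∞ := by
    refine ne_top_of_le_ne_top ?_ (ENNReal.tsum_le_tsum hs)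
    exact ((summable_pow_mul_exp_neg_rpow hc hγ 1).mul_left K).tsum_ofReal_ne_top
  filter_upwards [ae_eventually_notMem hsum] with ω hω
  filter_upwards [hω, eventually_ge_atTop N] with n hn hNn i hi
  apply hn
  simp only [s, if_pos hNn]
  exact Set.mem_iUnion.2 ⟨i, hi⟩

/-- Minkowski, in the form in which `e` is the uniform error on typical inputs and `h` the
contribution of the others. -/
lemma eLpNorm_le_add_of_abs_le {α : Type*} [MeasurableSpace α] {P : Measure α}
    [IsProbabilityMeasure P] {f f₀ h : α → ℝ} (hf₀ : AEStronglyMeasurable f₀ P)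
    (hh : AEStronglyMeasurable h P) {e T : ℝ} (he : 0 ≤ e) (hT : 0 ≤ T)
    (hle : ∀ᵐ z ∂P, |f z| ≤ |f₀ z| + e + h z)
    (hhT : eLpNorm h 2 P ≤ ENNReal.ofReal T) :
    eLpNorm f 2 P ≤ eLpNorm f₀ 2 P + ENNReal.ofReal (e + T) := by
  have h1 : eLpNorm f 2 P ≤ eLpNorm ((fun z => |f₀ z|) + ((fun _ => e) + h)) 2 P := by
    refine eLpNorm_mono_ae_real ?_
    filter_upwards [hle] with z hz
    simp only [Pi.add_apply, Real.norm_eq_abs]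
    linarith
  refine h1.trans ((eLpNorm_add_le hf₀.norm (aestronglyMeasurable_const.add hh)
    (by norm_num)).trans ?_)
  refine add_le_add (le_of_eq (eLpNorm_norm f₀)) ?_
  refine (eLpNorm_add_le aestronglyMeasurable_const hh (by norm_num)).trans ?_
  rw [ENNReal.ofReal_add he hT]
  refine add_le_add ?_ hhT
  rw [eLpNorm_const _ (by norm_num) (IsProbabilityMeasure.ne_zero P)]
  simp [Real.enorm_of_nonneg he]

/-- Passes from norms to squares although `z`, the root of the bias, may be large or infinite: for
`z ≥ B` the second bound on `y` suffices, and otherwise the cross term `2 z s` is at most `2 B s`.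
-/
lemma le_sq_add_ofReal {y z : ℝ≥0∞} {B s ε : ℝ} (hB : 0 ≤ B) (hs : 0 ≤ s)
    (hε : 2 * B * s + s ^ 2 ≤ ε) (h1 : y ≤ (z + ENNReal.ofReal s) ^ 2)
    (h2 : y ≤ ENNReal.ofReal B ^ 2) : y ≤ z ^ 2 + ENNReal.ofReal ε := by
  rcases le_or_gt (ENNReal.ofReal B) z with hz | hz
  · exact h2.trans ((pow_le_pow_left₀ zero_le hz 2).trans le_self_add)
  · have hzt : z ≠ ∞ := (hz.trans ENNReal.ofReal_lt_top).ne
    obtain ⟨w, hw0, rfl⟩ : ∃ w : ℝ, 0 ≤ w ∧ z = ENNReal.ofReal w :=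
      ⟨z.toReal, ENNReal.toReal_nonneg, (ENNReal.ofReal_toReal hzt).symm⟩
    have hwB : w ≤ B := by
      by_contra! hc
      exact absurd (ENNReal.ofReal_le_ofReal hc.le) (not_le.2 hz)
    refine h1.trans ?_
    have : 0 ≤ ε := le_trans (by positivity) hε
    rw [← ENNReal.ofReal_add hw0 hs, ← ENNReal.ofReal_pow (by positivity),
      ← ENNReal.ofReal_pow hw0, ← ENNReal.ofReal_add (by positivity) this]
    apply ENNReal.ofReal_le_ofReal
    nlinarith [mul_le_mul_of_nonneg_right hwB hs]

/-- The tail contribution to the `L²` distance vanishes. -/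
lemma tendsto_tail {c γ : ℝ} (hc : 0 < c) (hγ : 0 < γ) {D : ℝ} (hD : 0 ≤ D) (K Mo : ℝ) :
    Tendsto (fun n : ℕ => n * D * √(Real.exp (c / 2 * (n : ℝ) ^ γ) *
      ((n + 1) * K * Real.exp (-(c * (n : ℝ) ^ γ))) + Mo / Real.exp (c / 2 * (n : ℝ) ^ γ)))
      atTop (𝓝 0) := by
  have h2 := tendsto_pow_mul_exp_neg_rpow (half_pos hc) hγ 2
  have h3 := tendsto_pow_mul_exp_neg_rpow (half_pos hc) hγ 3
  have h4 := (((h3.mul_const K).add (h2.mul_const (K + Mo))).const_mul (D ^ 2)).sqrt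
  simp only [zero_mul, add_zero, mul_zero, Real.sqrt_zero] at h4
  refine h4.congr fun n => ?_
  have e1 : (n : ℝ) * D = √(((n : ℝ) * D) ^ 2) := (Real.sqrt_sq (by positivity)).symm
  rw [e1, ← Real.sqrt_mul (by positivity)]
  congr 1
  have e2 : Real.exp (-(c * (n : ℝ) ^ γ)) =
      Real.exp (-(c / 2 * (n : ℝ) ^ γ)) * Real.exp (-(c / 2 * (n : ℝ) ^ γ)) := by
    rw [← Real.exp_add]; congr 1; ring
  have e3 : Real.exp (c / 2 * (n : ℝ) ^ γ) * Real.exp (-(c / 2 * (n : ℝ) ^ γ)) = 1 := by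
    rw [← Real.exp_add]; simp
  have e4 : Mo / Real.exp (c / 2 * (n : ℝ) ^ γ) = Mo * Real.exp (-(c / 2 * (n : ℝ) ^ γ)) := by
    rw [Real.exp_neg]; rfl
  rw [e2, e4]
  linear_combination (-(n * D) ^ 2 * ((n + 1) * K * Real.exp (-(c / 2 * (n : ℝ) ^ γ)))) * e3

lemma tendsto_mul_rpow_neg_pow {b : ℝ} {k : ℕ} (hb : 1 < b * k) (A : ℝ) :
    Tendsto (fun n : ℕ => n * A * ((n : ℝ) ^ (-b)) ^ k) atTop (𝓝 0) := by
  have h1 := ((tendsto_rpow_neg_atTop (show 0 < b * k - 1 by linarith)).comp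
    (tendsto_natCast_atTop_atTop (R := ℝ))).const_mul A
  rw [mul_zero] at h1
  refine h1.congr' ?_
  filter_upwards [eventually_gt_atTop 0] with n hn
  have hn0 : (0 : ℝ) < n := by exact_mod_cast hn
  simp only [Function.comp_apply]
  rw [← Real.rpow_natCast, ← Real.rpow_mul hn0.le,
    show -(b * k - 1) = 1 + -b * k by ring, Real.rpow_add hn0, Real.rpow_one]
  ring

lemma eventually_effDim_ge {β c₀ : ℝ} (hβ : 0 < β) (hc₀ : 0 < c₀) {τ : ℕ → ℝ}
    (hτ : Tendsto (fun n : ℕ => τ n / (n : ℝ) ^ β) atTop (𝓝 c₀)) :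
    ∀ᶠ n : ℕ in atTop, 1 ≤ τ n ∧ c₀ / 2 * (n : ℝ) ^ β ≤ τ n := by
  have h1 := (tendsto_rpow_atTop hβ).comp (tendsto_natCast_atTop_atTop (R := ℝ))
  filter_upwards [hτ.eventually (lt_mem_nhds (show c₀ / 2 < c₀ by linarith)),
    h1.eventually_ge_atTop (2 / c₀), eventually_gt_atTop 0] with n h2 h3 hn
  have hn0 : (0 : ℝ) < n := by exact_mod_cast hn
  simp only [Function.comp_apply] at h3
  rw [lt_div_iff₀ (by positivity)] at h2
  refine ⟨?_, h2.le⟩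
  rw [div_le_iff₀ hc₀] at h3
  linarith

end PolyBarrier

end

/-! ### Assembly of the theorem -/

set_option maxHeartbeats 1000000 in
theorem theorem3
    -- the kernel function, the growth rate and the input model
    (g : ℝ → ℝ → ℝ → ℝ) (β : ℝ) (hβ : 0 < β) (model : PolyBarrier.InputModel)
    (hg : PolyBarrier.ExpansionAssumption model β g)
    -- covariance matrices, normalised to operator norm one, and the high-dimensional regime
    (d : ℕ → ℕ) (S : (n : ℕ) → Matrix (Fin (d n)) (Fin (d n)) ℝ)
    (hS : ∀ n, (S n).PosSemidef) (hS_norm : ∀ n, ‖S n‖ = 1)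
    (c₀ : ℝ) (hc₀ : 0 < c₀)
    (hd : Tendsto (fun n : ℕ => PolyBarrier.effDim (S n) / (n : ℝ) ^ β) atTop (𝓝 c₀))
    -- laws of the entries of the latent vectors
    (R : ℝ) (ν : ℕ → Measure ℝ) (hν : ∀ n, PolyBarrier.IsEntryLaw R (ν n))
    -- joint laws of input and response, with inputs in the domain of the kernel
    (𝒳 : (n : ℕ) → Set (PolyBarrier.E (d n)))
    (ρ : (n : ℕ) → Measure (𝒳 n × ℝ)) [∀ n, IsProbabilityMeasure (ρ n)]
    (hρ : ∀ n, (ρ n).fst.map Subtype.val = PolyBarrier.inputLaw model (S n) (ν n))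
    (hρ_int : ∀ n, Integrable Prod.snd (ρ n))
    -- the ground truth is bounded
    (B : ℝ) (hB : ∀ n, ∀ᵐ x ∂(ρ n).fst, |PolyBarrier.groundTruth (ρ n) x| ≤ B)
    -- the kernel at scale `τ = d_eff` is continuous, with reproducing kernel Hilbert space `H n`
    (hcont : ∀ n, Continuous fun p : 𝒳 n × 𝒳 n =>
      PolyBarrier.scaledKernel g (PolyBarrier.effDim (S n)) p.1.1 p.2.1)
    (H : ℕ → Type*) [∀ n, NormedAddCommGroup (H n)] [∀ n, InnerProductSpace ℝ (H n)]
    [∀ n, CompleteSpace (H n)] [∀ n, RKHS ℝ (H n) (𝒳 n) ℝ]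
    (hH : ∀ n (x x' : 𝒳 n), RKHS.kernel (H n) x x' 1 =
      PolyBarrier.scaledKernel g (PolyBarrier.effDim (S n)) x.1 x'.1)
    -- the data sets: for each `n`, `n` independent inputs with law `P_X`
    {Ω : Type*} [MeasurableSpace Ω] (μ : Measure Ω) [IsProbabilityMeasure μ]
    (X : (n : ℕ) → Fin n → Ω → 𝒳 n) (hX_law : ∀ n i, HasLaw (X n i) (ρ n).fst μ)
    (hX_indep : ∀ n, iIndepFun (X n) μ)
    -- the ridge parameters; the eigenvalues of `K + λ I` are asymptotically bounded below
    (lam : ℕ → ℝ) (hlam : ∀ n, 0 ≤ lam n)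
    (hK : ∃ c > 0, ∀ᵐ ω ∂μ, ∀ᶠ n in atTop,
      ∀ e ∈ spectrum ℝ (PolyBarrier.kernelMatrix g (PolyBarrier.effDim (S n))
        (fun i => X n i ω) + lam n • (1 : Matrix (Fin n) (Fin n) ℝ)), c ≤ e) :
    -- lower bound for the bias
    (∀ ε > 0, ∀ᵐ ω ∂μ, ∀ᶠ n in atTop,
      (⨅ p ∈ PolyBarrier.polySpace (d n) (PolyBarrier.barrierDegree model β),
        eLpNorm (fun z : 𝒳 n => PolyBarrier.groundTruth (ρ n) z - PolyBarrier.polyEval p z.1) 2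
          (ρ n).fst ^ 2) ≤
        PolyBarrier.bias (H n) (ρ n) (lam n) (fun i => X n i ω) + ENNReal.ofReal ε) ∧
    -- approximation of the averaged estimator by a polynomial depending on the data set
    (∃ p : (n : ℕ) → (Fin n → 𝒳 n) → MvPolynomial (Fin (d n)) ℝ,
      (∀ n x, p n x ∈ PolyBarrier.polySpace (d n) (PolyBarrier.barrierDegree model β)) ∧
      (∀ ε > 0, ∀ ε' > 0, ∃ C > 0, ∀ᵐ ω ∂μ, ∀ᶠ n : ℕ in atTop,
        1 - ENNReal.ofReal ((n : ℝ) ^ 2 * Real.exp (-C * Real.log n ^ (1 + ε'))) ≤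
          (ρ n).fst {z : 𝒳 n |
            |PolyBarrier.avgEstimator (H n) (ρ n) (lam n) (fun i => X n i ω) z -
              PolyBarrier.polyEval (p n fun i => X n i ω) z.1| ≤ ε}) ∧
      ((∃ M : ℝ, ∀ n, ∀ x ∈ (ρ n).fst.support, ∀ x' ∈ (ρ n).fst.support,
          |PolyBarrier.scaledKernel g (PolyBarrier.effDim (S n)) x.1 x'.1| ≤ M) →
        ∀ᵐ ω ∂μ, Tendsto (fun n =>
          eLpNorm (fun z : 𝒳 n =>
            PolyBarrier.avgEstimator (H n) (ρ n) (lam n) (fun i => X n i ω) z -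
              PolyBarrier.polyEval (p n fun i => X n i ω) z.1) 2 (ρ n).fst)
          atTop (𝓝 0))) := by
  open PolyBarrier in
  classical
  obtain ⟨I, a, C, hC, hI, hev⟩ := exists_polynomial_approx model β hg
  obtain ⟨δ, ⟨ha, happrox⟩, hδ0, hδ1⟩ := (hev.and (Ioc_mem_nhdsGT (one_pos (α := ℝ)))).exists
  obtain ⟨c, hc, hK⟩ := hK
  set v := max 1 (R ^ 2) with hvdef
  have hv : 1 ≤ v := le_max_left _ _
  have hν' : ∀ n, SubGaussianLaw v (ν n) := fun n => (hν n).subGaussianLaw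
  set q := ⌊2 / β⌋₊ with hq
  have hq1 : 2 / β < q + 1 := Nat.lt_floor_add_one _
  have hq0 : (0 : ℝ) < q + 1 := by positivity
  -- The choice that fixes the degree: the lower bound makes `n η^(q+1)` vanish, the upper one makes
  -- `η √τ`, of order `n^(β/2 - b)`, grow like a power. The interval is nonempty because `q + 1 > 2
  -- / β`.
  obtain ⟨b, hb1, hb2⟩ : ∃ b, 1 / ((q : ℝ) + 1) < b ∧ b < β / 2 := exists_between (by
    rw [div_lt_div_iff₀ hq0 two_pos]
    rw [div_lt_iff₀ hβ] at hq1
    linarith)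
  have hb0 : 0 < b := lt_trans (by positivity) hb1
  have hbq : 1 < b * ((q + 1 : ℕ) : ℝ) := by
    rw [div_lt_iff₀ hq0] at hb1
    push_cast; exact hb1
  set γ := β / 2 - b with hγdef
  have hγ : 0 < γ := by rw [hγdef]; linarith
  set κ := √(c₀ / 2) / (32 * v) with hκdef
  have hκ : 0 < κ := by positivity
  have hB0 : 0 ≤ |B| := abs_nonneg B
  have hFB : ∀ n, ∀ᵐ x ∂(ρ n).fst, |groundTruth (ρ n) x| ≤ |B| := fun n => by
    filter_upwards [hB n] with x hx using hx.trans (le_abs_self B)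
  -- sequences
  set τ : ℕ → ℝ := fun n => effDim (S n) with hτdef
  set η : ℕ → ℝ := fun n => (n : ℝ) ^ (-b) with hηdef
  have hη0 : ∀ n, 0 ≤ η n := fun n => by positivity
  have hηlim : Tendsto η atTop (𝓝 0) :=
    (tendsto_rpow_neg_atTop hb0).comp (tendsto_natCast_atTop_atTop (R := ℝ))
  let t : (n : ℕ) → 𝒳 n → ℝ := fun n z => ‖(z : E (d n))‖ ^ 2 / τ n
  have htm : ∀ n, Measurable (t n) := fun n => measurable_normSq_div (τ n)
  set m := barrierDegree model β with hm
  let p : (n : ℕ) → (Fin n → 𝒳 n) → MvPolynomial (Fin (d n)) ℝ := fun n x =>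
    approxPoly I a (τ n) (avgCoeff g (τ n) (ρ n) (lam n) x) fun i => (x i : E (d n))
  have hp : ∀ n x, p n x ∈ polySpace (d n) m := fun n x => approxPoly_mem_polySpace a _ _ _ hI
  let Good : (n : ℕ) → (Fin n → 𝒳 n) → Prop := fun n x =>
    GoodData (ρ n) model g (τ n) δ |B| c (lam n) x
  let G : (n : ℕ) → (Fin n → 𝒳 n) → Set (𝒳 n) := fun n x => goodSet model (τ n) (η n) x
  have hGm : ∀ n x, MeasurableSet (G n x) := fun n x => measurableSet_goodSet _ _ _ _
  let bad : ℕ → ℝ := fun n => (n + 1) * tailConst v * Real.exp (-(κ * (n : ℝ) ^ γ))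
  have hbad0 : ∀ n, 0 ≤ bad n := fun n => by have := (tailConst_pos v).le; positivity
  let err : ℕ → ℝ := fun n => n * (|B| / c * C) * η n ^ (q + 1)
  have herr0 : ∀ n, 0 ≤ err n := fun n => by have := hη0 n; positivity
  have herr : Tendsto err atTop (𝓝 0) := tendsto_mul_rpow_neg_pow hbq _
  -- typical behaviour of the dimension
  have hlarge : ∀ᶠ n : ℕ in atTop, 1 ≤ n ∧ 1 ≤ τ n ∧ η n ≤ δ ∧
      κ * (n : ℝ) ^ γ ≤ η n * √(τ n) / (32 * v) := by
    filter_upwards [eventually_ge_atTop 1, eventually_effDim_ge hβ hc₀ hd,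
      hηlim.eventually (gt_mem_nhds hδ0)] with n hn hτn hηn
    refine ⟨hn, hτn.1, hηn.le, ?_⟩
    have hn0 : (0 : ℝ) < n := by exact_mod_cast hn
    have e1 : √(c₀ / 2) * (n : ℝ) ^ (β / 2) ≤ √(τ n) := by
      have e2 : (n : ℝ) ^ (β / 2) = √((n : ℝ) ^ β) := by
        rw [Real.sqrt_eq_rpow, ← Real.rpow_mul hn0.le]; congr 1; ring
      rw [e2, ← Real.sqrt_mul (by positivity)]
      exact Real.sqrt_le_sqrt hτn.2
    have e3 : (n : ℝ) ^ γ = η n * (n : ℝ) ^ (β / 2) := by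
      simp only [hηdef]
      rw [← Real.rpow_add hn0]; congr 1; rw [hγdef]; ring
    rw [e3, hκdef]
    have e4 := mul_le_mul_of_nonneg_left e1 (hη0 n)
    rw [div_mul_eq_mul_div]
    have e5 : √(c₀ / 2) * (η n * (n : ℝ) ^ (β / 2)) ≤ η n * √(τ n) := by linarith
    exact div_le_div_of_nonneg_right e5 (by positivity)
  have hbadG : ∀ᶠ n in atTop, ∀ x, Good n x → (ρ n).fst (G n x)ᶜ ≤ ENNReal.ofReal (bad n) := by
    filter_upwards [hlarge] with n hn x hx
    refine (measure_compl_goodSet_le (hρ n) (hS n) (hS_norm n) (hν' n) hv hn.2.1 (hη0 n)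
      (hn.2.2.1.trans hδ1) x fun i => ?_).trans (ENNReal.ofReal_le_ofReal ?_)
    · have := abs_le.1 ((hx.normGood i).abs_sub_one_le hδ0.le)
      have h2 : ‖(x i : E (d n))‖ ^ 2 / effDim (S n) - 1 ≤ δ := this.2
      linarith
    · have := (tailConst_pos v).le
      exact mul_le_mul_of_nonneg_left (Real.exp_le_exp.2 (neg_le_neg hn.2.2.2)) (by positivity)
  have hgood : ∀ᵐ ω ∂μ, ∀ᶠ n in atTop, Good n fun i => X n i ω := by
    have h1 : ∀ᵐ ω ∂μ, ∀ᶠ n in atTop, ∀ i,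
        X n i ω ∉ {z : 𝒳 n | ¬ NormGood model δ (‖(z : E (d n))‖ ^ 2 / effDim (S n))} := by
      refine ae_eventually_forall_notMem hX_law (fun n =>
        (measurableSet_normGood model δ).compl.preimage (measurable_normSq_div _))
        (K := tailConst v) hκ hγ ?_
      filter_upwards [hlarge] with n hn
      refine (measure_mono ?_).trans ((measure_not_normGood_le (hρ n) (hS n) (hS_norm n) (hν' n)
        hv hn.2.1 (hη0 n) (hn.2.2.1.trans hδ1)).trans (ENNReal.ofReal_le_ofReal ?_))
      -- Data points need only be typical at the fixed scale `δ`; as `η n ≤ δ`, the bound at scale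
      -- `η n` covers this.
      · intro z hz hcon
        exact hz (hcon.mono hn.2.2.1)
      · exact mul_le_mul_of_nonneg_left (Real.exp_le_exp.2 (neg_le_neg hn.2.2.2))
          (tailConst_pos v).le
    have h2 : ∀ᵐ ω ∂μ, ∀ n i, |groundTruth (ρ n) (X n i ω)| ≤ |B| ∧
        Integrable (fun y => y) ((ρ n).condKernel (X n i ω)) ∧ X n i ω ∈ (ρ n).fst.support := by
      rw [ae_all_iff]; intro n
      rw [ae_all_iff]; intro i
      have h3 : ∀ᵐ z ∂(ρ n).fst, |groundTruth (ρ n) z| ≤ |B| ∧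
          Integrable (fun y => y) ((ρ n).condKernel z) ∧ z ∈ (ρ n).fst.support := by
        filter_upwards [hFB n, (hρ_int n).condKernel_ae, Measure.support_mem_ae] with z h4 h5 h6
        exact ⟨h4, h5, h6⟩
      rw [← (hX_law n i).map_eq] at h3
      have h4 := ae_of_ae_map (hX_law n i).aemeasurable h3
      rw [(hX_law n i).map_eq] at h4
      exact h4
    filter_upwards [h1, h2, hK] with ω h1 h2 h3
    filter_upwards [h1, h3] with n h1 h3
    exact ⟨fun i => by_contra fun h => h1 i h, fun i => (h2 n i).1, fun i => (h2 n i).2.1,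
      fun i => (h2 n i).2.2, h3⟩
  -- deterministic approximation
  have hacc : ∀ᶠ n in atTop, ∀ x, Good n x → ∀ z ∈ G n x,
      |avgEstimator (H n) (ρ n) (lam n) x z - polyEval (p n x) z.1| ≤ err n := by
    filter_upwards [hlarge] with n hn x hx z hz
    rw [hx.avgEstimator_eq (hH n) hc (hlam n)]
    refine (abs_sum_scaledKernel_sub_approxPoly_le (D := C * η n ^ (q + 1))
      (mul_nonneg hC (pow_nonneg (hη0 n) _)) (hx.sum_abs_avgCoeff_le (hH n) hc hB0)
      fun i => ?_).trans (le_of_eq ?_)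
    · exact happrox (η n) (hη0 n) hn.2.2.1 _ _ _ (hx.normGood i) hz.1 (hz.2 i)
    · simp only [err]; ring
  have hgrow : ∀ᶠ n in atTop, ∀ x, Good n x → ∀ z,
      |polyEval (p n x) z.1| ≤ n * (|B| / c * (I.card * C)) * (1 + t n z) ^ m := by
    filter_upwards [hlarge] with n hn x hx z
    refine (abs_polyEval_approxPoly_le (by linarith [hn.2.1]) hC hδ1 hI ha
      (hx.sum_abs_avgCoeff_le (hH n) hc hB0)
      (fun i => (hx.normGood i).abs_sub_one_le hδ0.le) z.1).trans (le_of_eq ?_)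
    simp only [t]; ring
  have ht0 : ∀ᶠ n in atTop, ∀ z, 0 ≤ t n z := by
    filter_upwards [hlarge] with n hn z
    have : 0 < τ n := by linarith [hn.2.1]
    positivity
  -- Here `r = exp (κ n^γ / 2)`: both `r * bad n` and `1 / r` decay like `exp (-κ n^γ / 2)`, up to a
  -- factor linear in `n`.
  let T : ℝ → ℕ → ℝ := fun D n => n * D * √(Real.exp (κ / 2 * (n : ℝ) ^ γ) * bad n +
    momentConst v (4 * m) / Real.exp (κ / 2 * (n : ℝ) ^ γ))
  have hT : ∀ D, 0 ≤ D → Tendsto (T D) atTop (𝓝 0) := fun D hD => tendsto_tail hκ hγ hD _ _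
  have hmom : 0 ≤ momentConst v (4 * m) := by unfold momentConst; positivity
  let h : ℝ → (n : ℕ) → (Fin n → 𝒳 n) → 𝒳 n → ℝ := fun D n x =>
    (G n x)ᶜ.indicator fun z => n * D * (1 + t n z) ^ m
  have hhm : ∀ D n x, AEStronglyMeasurable (h D n x) (ρ n).fst := fun D n x =>
    (Measurable.indicator (by have := htm n; fun_prop) (hGm n x).compl).aestronglyMeasurable
  have htail : ∀ D, 0 ≤ D → ∀ᶠ n in atTop, ∀ x, Good n x →
      eLpNorm (h D n x) 2 (ρ n).fst ≤ ENNReal.ofReal (T D n) := by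
    intro D hD
    filter_upwards [hlarge, hbadG, ht0] with n hn hbG ht x hx
    exact eLpNorm_indicator_compl_le (htm n) ht (hGm n x) (Real.exp_pos _) (hbad0 n) hmom
      (by positivity) (hbG x hx) (lintegral_normSq_pow_le (hρ n) (hS n) (hS_norm n) (hν' n)
        (by linarith) (by linarith [hn.2.1]) _)
  refine ⟨?_, p, hp, ?_, ?_⟩
  · -- lower bound for the bias
    intro ε hε
    -- Off the good set the tail `h` dominates `|f⋆| + |p|` alone, so no bound on the estimator,
    -- hence none on the kernel, is needed.
    set D := |B| / c * (I.card * C) + |B| with hD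
    have hD0 : 0 ≤ D := by positivity
    have hs : Tendsto (fun n => 2 * |B| * (err n + T D n) + (err n + T D n) ^ 2) atTop (𝓝 0) := by
      have h1 := herr.add (hT D hD0)
      have h2 := (h1.const_mul (2 * |B|)).add (h1.pow 2)
      simpa using h2
    filter_upwards [hgood] with ω hω
    filter_upwards [hω, hlarge, hacc, hgrow, ht0, htail D hD0, hs.eventually (gt_mem_nhds hε)]
      with n hx hn hacc hgrow ht htail hs
    set x : Fin n → 𝒳 n := fun i => X n i ω
    have hn1 : (1 : ℝ) ≤ n := by exact_mod_cast hn.1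
    have hFm : AEStronglyMeasurable (groundTruth (ρ n)) (ρ n).fst :=
      (hρ_int n).aestronglyMeasurable.integral_condKernel
    have hAm : AEStronglyMeasurable (avgEstimator (H n) (ρ n) (lam n) x) (ρ n).fst :=
      (hx.measurable_avgEstimator (hH n) hc (hlam n) (hcont n)).aestronglyMeasurable
    have hT0 : 0 ≤ T D n := by
      have := hbad0 n
      positivity
    have hle : eLpNorm (fun z : 𝒳 n => groundTruth (ρ n) z - polyEval (p n x) z.1) 2 (ρ n).fst ≤
        eLpNorm (fun z => avgEstimator (H n) (ρ n) (lam n) x z - groundTruth (ρ n) z) 2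
          (ρ n).fst + ENNReal.ofReal (err n + T D n) := by
      refine eLpNorm_le_add_of_abs_le (h := h D n x) (hAm.sub hFm) (hhm D n x) (herr0 n) hT0 ?_
        (htail x hx)
      filter_upwards [hFB n] with z hz
      by_cases hzG : z ∈ G n x
      · have h1 := hacc x hx z hzG
        have h2 : h D n x z = 0 := Set.indicator_of_notMem (Set.notMem_compl_iff.2 hzG) _
        rw [h2, add_zero, Pi.sub_apply, abs_sub_comm (avgEstimator (H n) (ρ n) (lam n) x z)]
        exact (abs_sub_le _ (avgEstimator (H n) (ρ n) (lam n) x z) _).trans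
          (add_le_add le_rfl h1)
      · have h2 : h D n x z = n * D * (1 + t n z) ^ m := Set.indicator_of_mem hzG _
        have h1 := hgrow x hx z
        have h3 : 1 ≤ (1 + t n z) ^ m := one_le_pow₀ (by linarith [ht z])
        have h4 : |B| ≤ n * |B| * (1 + t n z) ^ m := by
          have := mul_le_mul hn1 h3 zero_le_one (by positivity)
          nlinarith
        have h5 : h D n x z = n * (|B| / c * (I.card * C)) * (1 + t n z) ^ m +
            n * |B| * (1 + t n z) ^ m := by rw [h2, hD]; ring
        have h6 := abs_nonneg (avgEstimator (H n) (ρ n) (lam n) x z - groundTruth (ρ n) z)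
        have h7 := abs_sub (groundTruth (ρ n) z) (polyEval (p n x) z.1)
        have h8 := herr0 n
        rw [h5, Pi.sub_apply]
        linarith
    refine le_sq_add_ofReal hB0 (add_nonneg (herr0 n) hT0) hs.le ?_ ?_
    · exact (iInf₂_le (p n x) (hp n x)).trans (pow_le_pow_left₀ zero_le hle 2)
    -- The zero polynomial bounds the infimum by `|B|²`.
    · refine (iInf₂_le (0 : MvPolynomial (Fin (d n)) ℝ) (by simp [polySpace])).trans
        (pow_le_pow_left₀ zero_le ?_ 2)
      refine (eLpNorm_le_of_ae_bound (C := |B|) ?_).trans (by simp)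
      filter_upwards [hFB n] with z hz
      simpa [polyEval] using hz
  · -- approximation with high probability
    intro ε hε ε' _
    -- The true failure probability is stretched-exponential in a power of `n`, so any `C` would do.
    refine ⟨1, one_pos, ?_⟩
    filter_upwards [hgood] with ω hω
    filter_upwards [hω, hacc, hbadG, herr.eventually (gt_mem_nhds hε),
      eventually_exp_neg_rpow_le (K := tailConst v) hκ hγ ((1 + ε' : ℕ) : ℝ)] with n hx hacc hbG herr hexp
    have h1 : (ρ n).fst (G n fun i => X n i ω) ≤ _ :=
      measure_mono fun z hz => (hacc _ hx z hz).trans herr.le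
    refine le_trans ?_ h1
    have h2 := prob_compl_eq_one_sub (μ := (ρ n).fst) (hGm n fun i => X n i ω).compl
    rw [compl_compl] at h2
    rw [h2]
    -- In the statement `ε'` ranges over the natural numbers, so the power of the logarithm is a
    -- monoid power. This loses nothing: once `log n ≥ 1`, larger exponents give stronger bounds.
    rw [Real.rpow_natCast] at hexp
    exact tsub_le_tsub_left ((hbG _ hx).trans (ENNReal.ofReal_le_ofReal hexp)) 1
  · -- approximation in `L²`
    rintro ⟨M, hM⟩
    -- The tail now dominates `|p|` and the estimator, which is at most `n |B| |M| / c` on the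
    -- support of the input law.
    set D := |B| / c * (I.card * C) + |B| / c * |M| with hD
    have hD0 : 0 ≤ D := by positivity
    filter_upwards [hgood] with ω hω
    have hlim : Tendsto (fun n => ENNReal.ofReal (err n + T D n)) atTop (𝓝 0) := by
      have h1 := ENNReal.tendsto_ofReal (herr.add (hT D hD0))
      simpa using h1
    refine tendsto_of_tendsto_of_tendsto_of_le_of_le' tendsto_const_nhds hlim
      (Eventually.of_forall fun n => zero_le) ?_
    filter_upwards [hω, hlarge, hacc, hgrow, ht0, htail D hD0] with n hx hn hacc hgrow ht htail
    set x : Fin n → 𝒳 n := fun i => X n i ω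
    have hT0 : 0 ≤ T D n := by
      have := hbad0 n
      positivity
    refine (eLpNorm_le_add_of_abs_le (f₀ := fun _ => 0) (h := h D n x) aestronglyMeasurable_const
      (hhm D n x) (herr0 n) hT0 ?_ (htail x hx)).trans (le_of_eq (by simp))
    filter_upwards [Measure.support_mem_ae] with z hz
    by_cases hzG : z ∈ G n x
    · have h1 := hacc x hx z hzG
      have h2 : h D n x z = 0 := Set.indicator_of_notMem (Set.notMem_compl_iff.2 hzG) _
      rw [h2, abs_zero, zero_add, add_zero]
      exact h1
    · have h2 : h D n x z = n * D * (1 + t n z) ^ m := Set.indicator_of_mem hzG _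
      have h1 := hgrow x hx z
      have h3 : 1 ≤ (1 + t n z) ^ m := one_le_pow₀ (by linarith [ht z])
      have h4 := hx.abs_avgEstimator_le (hH n) hc hB0 (hlam n) (abs_nonneg M)
        (fun x hx x' hx' => (hM n x hx x' hx').trans (le_abs_self M)) hz
      have h5 : (n : ℝ) * |B| / c * |M| ≤ n * (|B| / c * |M|) * (1 + t n z) ^ m := by
        have h6 : 0 ≤ (n : ℝ) * (|B| / c * |M|) := by positivity
        have h7 : (n : ℝ) * |B| / c * |M| = n * (|B| / c * |M|) := by ring
        rw [h7]
        exact le_mul_of_one_le_right h6 h3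
      have h6 : h D n x z = n * (|B| / c * (I.card * C)) * (1 + t n z) ^ m +
          n * (|B| / c * |M|) * (1 + t n z) ^ m := by rw [h2, hD]; ring
      have h7 := abs_sub (avgEstimator (H n) (ρ n) (lam n) x z) (polyEval (p n x) z.1)
      have h8 := herr0 n
      rw [h6, abs_zero]
      linarith
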